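/- Let $X=(X_t)_{t\ge 0}$ be a Poisson process with intensity $\lambda>0$ and let $n>0$ be real. Write $\phi_Z(u)=\mathsf{E}\,e^{-uZ}$, let $\Gamma(a,x)$ be the upper incomplete gamma function, and for $s\in(0,1]$ let $\mathrm{Q}(n,s)$ be the unique $x\ge 0$ with $\Gamma(n,x)/\Gamma(n)=s$. Averaged processes of degree $n$ (all equal to $0$ at $t=0$; formulas for $t>0$): Type I: for integer $n\ge1$, $\bar X^{(n)}_t=\frac1t\int_0^t\bar X^{(n-1)}_s\,ds$ with $\bar X^{(0)}=X$; for every real $n>0$, $\bar X^{(n)}_t=\frac{1}{t\,\Gamma(n)}\int_0^t X_s\log^{n-1}(t/s)\,ds$. Type II: for integer $n\ge1$, $\tilde X^{(n)}_t=\frac1t\int_0^tY^{(n-1)}_s\,ds$, where $Y^{(0)}=X$ and $Y^{(k)}$ is a Lévy process with $Y^{(k)}_t\overset{d}{=}\tilde X^{(k)}_t$ for all $t$; for every real $n>0$, $\tilde X^{(n)}$ is a process with $\phi_{\tilde X^{(n)}_t}(u)=\exp\Big(\frac{t}{\Gamma(n)}\int_0^1(-\log v)^{n-1}\log\phi_{X_1}(uv)\,dv\Big)$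 for $\Re u\ge0$. Type III: for integer $n\ge1$, $\breve X^{(n)}_t$ is $t^{-n}$ times the $n$-fold iterated integral of $X$ over $[0,t]$; for every real $n>0$, $\breve X^{(n)}_t=\frac{1}{t^n\Gamma(n)}\int_0^t(t-s)^{n-1}X_s\,ds$. The type-I, II, III regulated clocks of degree $n$ are the Lévy processes whose one-dimensional laws are those of $\bar X^{(n)},\tilde X^{(n)},\breve X^{(n)}$ respectively. Then, whichever of the above descriptions of the averaged processes applies: (a) For all $u\in\mathbb{C}$, $$\phi_{\bar X^{(n)}_1}(u)=\exp\Big(\lambda\Big(\Gamma(n)\int_0^1\frac{e^{-uz}}{\mathrm{Q}^{n-1}(n,1-z)}\,dz-1\Big)\Big),$$ $$\phi_{\tilde X^{(n)}_1}(u)=\exp\Big(\frac{\lambda}{\Gamma(n)}\int_0^1(-\log v)^{n-1}(e^{-uv}-1)\,dv\Big),$$ and if $n$ is a positive integer the latter equals $\exp\big(\lambda\big({}_nF_n(1,\dots,1;2,\dots,2;-u)-1\big)\big)$, where ${}_nF_n$ is the generalized hypergeometric function. Moreover $$\phi_{\breve X^{(n)}_1}(u)=\exp\Big(\lambda\Big(\Big(\frac{\Gamma(n+1)}{u}\Big)^{1/n}\frac{\Gamma(1/n)-\Gamma(1/n,u/\Gamma(n+1))}{n}-1\Big)\Big),$$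 where the powers and the incomplete gamma function are taken on one and the same branch: with principal branches this holds as written for $u\in\mathbb{C}\setminus(-\infty,0]$, and for all $u\neq0$ when $(\Gamma(n+1)/u)^{1/n}$ is read as $(u/\Gamma(n+1))^{-1/n}$ (argument in $(-\pi,\pi]$, and $\Gamma(a,w)=\int_0^\infty(w+t)^{a-1}e^{-(w+t)}\,dt$); at $u=0$ it holds by continuous extension. (b) The Lévy measures of the three regulated clocks have the densities ($z>0$) $$\bar\ell^{(n)}(z)=\frac{\lambda\,\Gamma(n)\,1_{(0,1]}(z)}{\mathrm{Q}^{n-1}(n,1-z)},\qquad \tilde\ell^{(n)}(z)=\frac{\lambda(-\log z)^{n-1}1_{(0,1]}(z)}{\Gamma(n)},\qquad \breve\ell^{(n)}(z)=\frac{\lambda(\Gamma(n+1)z)^{1/n}\,1_{(0,1/\Gamma(n+1)]}(z)}{nz}.$$ That is, for $\nu(dz)=\ell(z)\,dz$ with the corresponding $\ell$, $\int(z\wedge1)\,\nu(dz)<\infty$ and the law at time $1$ has Laplace transform $\exp\int_0^\infty(e^{-uz}-1)\,\nu(dz)$ for $\Re u\ge0$. In particular the regulated clocks are compound Poisson processes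 with jump intensity $\lambda$ and jump law $\ell(z)\,dz/\lambda$, concentrated on $(0,1]$ for types I and II and on $(0,1/\Gamma(n+1)]$ for type III. -/

import Mathlib

open MeasureTheory ProbabilityTheory Set Filter Topology
open scoped NNReal ENNReal Nat

universe u v

noncomputable section

namespace RegulatedClock

/-! ### Special functions -/

/-- The upper incomplete gamma function `Γ(a, x) = ∫_x^∞ t^(a-1) e^(-t) dt`, real `x ≥ 0`. -/
def upperGamma (a x : ℝ) : ℝ := ∫ t in Ioi x, t ^ (a - 1) * Real.exp (-t)

/-- The upper incomplete gamma function `Γ(a, w) = ∫_w^∞ t^(a-1) e^(-t) dt` of a complex argument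
`w` (for `Re a > 0`), the integral being along the horizontal ray from `w` to `w + ∞`, with the
principal branch of the power (argument in `(-π, π]`). -/
def complexUpperGamma (a w : ℂ) : ℂ :=
  ∫ t in Ioi (0 : ℝ), (w + t) ^ (a - 1) * Complex.exp (-(w + t))

/-- The inverse regularized upper incomplete gamma function: for `n > 0` and `s ∈ (0, 1]` the
unique `x ≥ 0` with `Γ(n, x) / Γ(n) = s` (the infimum is over a singleton). -/
def inverseGammaQ (n s : ℝ) : ℝ := sInf {x : ℝ | 0 ≤ x ∧ upperGamma n x / Real.Gamma n = s}

/-- The generalized hypergeometric function `_pF_q(a; b; z)`, where `p`, `q` are the lengths of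
the parameter lists `a`, `b`. -/
def genHypergeometric (a b : List ℂ) (z : ℂ) : ℂ :=
  ∑' k : ℕ, (a.map fun α => (ascPochhammer ℂ k).eval α).prod /
    (b.map fun β => (ascPochhammer ℂ k).eval β).prod * z ^ k / (k ! : ℂ)

/-! ### Lévy processes -/

/-- A real-valued Lévy process on a probability space. -/
structure IsLevyProcess {Ω : Type u} [MeasurableSpace Ω] (X : ℝ≥0 → Ω → ℝ) (P : Measure Ω) :
    Prop where
  isProbabilityMeasure : IsProbabilityMeasure P
  measurable : ∀ t, Measurable (X t)
  zero : ∀ᵐ ω ∂P, X 0 ω = 0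
  indep : HasIndepIncrements X P
  stationary : ∀ s h : ℝ≥0,
    IdentDistrib (fun ω => X (s + h) ω - X s ω) (fun ω => X h ω - X 0 ω) P P
  cadlag : ∀ᵐ ω ∂P, ∀ t : ℝ≥0, ContinuousWithinAt (fun s => X s ω) (Ici t) t ∧
    ∃ l : ℝ, Tendsto (fun s => X s ω) (𝓝[<] t) (𝓝 l)

/-- A Poisson process with intensity `lam`. -/
structure IsPoissonProcess {Ω : Type u} [MeasurableSpace Ω] (X : ℝ≥0 → Ω → ℝ) (lam : ℝ≥0)
    (P : Measure Ω) : Prop where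
  levy : IsLevyProcess X P
  law : ∀ t : ℝ≥0, P.map (X t) = (poissonMeasure (lam * t)).map (fun k : ℕ => (k : ℝ))

/-- The Laplace transform `E e^(-uZ)` of a real random variable `Z`. -/
def laplace {Ω : Type u} [MeasurableSpace Ω] (Z : Ω → ℝ) (P : Measure Ω) (u : ℂ) : ℂ :=
  complexMGF Z P (-u)

/-- `ψ` is the logarithm of the Laplace transform of `Z` on the closed right half-plane:
the continuous one that vanishes at `0`. -/
def IsLogLaplace {Ω : Type u} [MeasurableSpace Ω] (Z : Ω → ℝ) (P : Measure Ω) (ψ : ℂ → ℂ) :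
    Prop :=
  ContinuousOn ψ {u : ℂ | 0 ≤ u.re} ∧ ψ 0 = 0 ∧
    ∀ u : ℂ, 0 ≤ u.re → laplace Z P u = Complex.exp (ψ u)

/-- The law `μ` on the half-line has the characterizing triplet `(0, 0, ν)`: `ν` is a Lévy
measure on `(0, ∞)` with `∫ (z ∧ 1) ν(dz) < ∞`, and
`∫ e^(-ux) μ(dx) = exp (∫ (e^(-uz) - 1) ν(dz))` for `Re u ≥ 0`. -/
def HasLevyMeasure (μ ν : Measure ℝ) : Prop :=
  ν (Iic 0) = 0 ∧ ∫⁻ z, ENNReal.ofReal (min z 1) ∂ν < ∞ ∧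
    ∀ u : ℂ, 0 ≤ u.re → ∫ x : ℝ, Complex.exp (-u * x) ∂μ =
      Complex.exp (∫ z : ℝ, (Complex.exp (-u * z) - 1) ∂ν)

/-- The measure `f(z) dz`. -/
def densityMeasure (f : ℝ → ℝ) : Measure ℝ := volume.withDensity fun z => ENNReal.ofReal (f z)

/-- `k`-fold convolution power of a law `ρ`. -/
def convPow (ρ : Measure ℝ) : ℕ → Measure ℝ
  | 0 => Measure.dirac 0
  | k + 1 => (convPow ρ k).conv ρ

/-- The law of `J_1 + ... + J_N`, with `N` Poisson of mean `r` independent of the i.i.d.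
variables `J_i` of law `ρ`. -/
def compoundPoissonLaw (r : ℝ≥0) (ρ : Measure ℝ) : Measure ℝ :=
  (poissonMeasure r).bind (convPow ρ)

/-- `W` is a compound Poisson process with jump intensity `r` and jump law `ρ`. -/
structure IsCompoundPoissonProcess {Ω : Type u} [MeasurableSpace Ω] (W : ℝ≥0 → Ω → ℝ)
    (Q : Measure Ω) (r : ℝ≥0) (ρ : Measure ℝ) : Prop where
  levy : IsLevyProcess W Q
  jump_probability : IsProbabilityMeasure ρ
  jump_ne_zero : ρ {0} = 0
  law : ∀ t : ℝ≥0, Q.map (W t) = compoundPoissonLaw (r * t) ρ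

/-- `W` is a Lévy process induced by the process `A`: `W_t` has the law of `A_t` for each `t`. -/
def IsInducedClock {Ω : Type u} [MeasurableSpace Ω] (A : ℝ≥0 → Ω → ℝ) (P : Measure Ω)
    {Ω' : Type v} [MeasurableSpace Ω'] (W : ℝ≥0 → Ω' → ℝ) (Q : Measure Ω') : Prop :=
  IsLevyProcess W Q ∧ ∀ t, IdentDistrib (W t) (A t) Q P

/-! ### The three recipes -/

/-- The pathwise integral `∫_0^t X_s ds`. -/
def runningIntegral {Ω : Type u} (X : ℝ≥0 → Ω → ℝ) (t : ℝ≥0) (ω : Ω) : ℝ :=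
  ∫ s in (0 : ℝ)..t, X s.toNNReal ω

/-- The running average `(1/t) ∫_0^t X_s ds`, equal to `0` at `t = 0`. -/
def runningAverage {Ω : Type u} (X : ℝ≥0 → Ω → ℝ) (t : ℝ≥0) (ω : Ω) : ℝ :=
  (t : ℝ)⁻¹ * runningIntegral X t ω

/-- The averaged process of the first recipe, of real degree `n > 0`: for integer `n` the `n`-fold
running average of `X`, and for any `n` the fractional (logarithmic) integral
`(1/(t Γ(n))) ∫_0^t X_s log^(n-1)(t/s) ds`. -/
inductive IsTypeIAverage {Ω : Type u} (X : ℝ≥0 → Ω → ℝ) : ℝ → (ℝ≥0 → Ω → ℝ) → Prop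
  | recipe (k : ℕ) (hk : 1 ≤ k) : IsTypeIAverage X k (runningAverage^[k] X)
  | fractional (n : ℝ) (hn : 0 < n) : IsTypeIAverage X n (fun t ω =>
      1 / ((t : ℝ) * Real.Gamma n) *
        ∫ s in (0 : ℝ)..t, X s.toNNReal ω * Real.log (t / s) ^ (n - 1))

/-- Regulated clocks of the second recipe, of integer degree: degree `0` is (a copy of) the Lévy
process `X`, and a clock of degree `k + 1` is a Lévy process induced by the running average of a
clock of degree `k`. -/
def IsTypeIIClock {Ω : Type u} [MeasurableSpace Ω] (X : ℝ≥0 → Ω → ℝ) (P : Measure Ω) :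
    ℕ → ∀ {Ω' : Type u} [MeasurableSpace Ω'], (ℝ≥0 → Ω' → ℝ) → Measure Ω' → Prop
  | 0, _, _, Y, Q => IsInducedClock X P Y Q
  | k + 1, _, _, Y, Q => ∃ (Ω₀ : Type u) (_ : MeasurableSpace Ω₀) (Y₀ : ℝ≥0 → Ω₀ → ℝ)
      (Q₀ : Measure Ω₀), IsTypeIIClock X P k Y₀ Q₀ ∧ IsInducedClock (runningAverage Y₀) Q₀ Y Q

/-- The averaged process of the second recipe, of real degree `n > 0`: for integer `n` the running
average of a regulated clock of degree `n - 1`; for any `n`, a process whose log-Laplace transform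
at time `t` is the `n`-degree average of that of `X_1`,
`(t / Γ(n)) ∫_0^1 (-log v)^(n-1) log φ_{X_1}(uv) dv`, `Re u ≥ 0`. -/
inductive IsTypeIIAverage {Ω : Type u} [MeasurableSpace Ω] (X : ℝ≥0 → Ω → ℝ) (P : Measure Ω)
    {Ω' : Type u} [MeasurableSpace Ω'] (Q : Measure Ω') : ℝ → (ℝ≥0 → Ω' → ℝ) → Prop
  | recipe (k : ℕ) (Y : ℝ≥0 → Ω' → ℝ) (hY : IsTypeIIClock X P k Y Q) :
      IsTypeIIAverage X P Q ((k + 1 : ℕ) : ℝ) (runningAverage Y)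
  | fractional (n : ℝ) (hn : 0 < n) (A : ℝ≥0 → Ω' → ℝ) (hQ : IsProbabilityMeasure Q)
      (hA : ∀ t, AEMeasurable (A t) Q) (ψ : ℂ → ℂ) (hψ : IsLogLaplace (X 1) P ψ)
      (h : ∀ (t : ℝ≥0) (u : ℂ), 0 ≤ u.re → laplace (A t) Q u =
        Complex.exp ((t : ℂ) / (Real.Gamma n : ℂ) *
          ∫ v in (0 : ℝ)..1, (((-Real.log v) ^ (n - 1) : ℝ) : ℂ) * ψ (u * v))) :
      IsTypeIIAverage X P Q n A

/-- The averaged process of the third recipe, of real degree `n > 0`: for integer `n` the `n`-fold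
iterated integral of `X` divided by `t^n`, and for any `n` the Riemann-Liouville integral
`(1/(t^n Γ(n))) ∫_0^t (t-s)^(n-1) X_s ds`. -/
inductive IsTypeIIIAverage {Ω : Type u} (X : ℝ≥0 → Ω → ℝ) : ℝ → (ℝ≥0 → Ω → ℝ) → Prop
  | recipe (k : ℕ) (hk : 1 ≤ k) : IsTypeIIIAverage X k (fun t ω =>
      1 / (t : ℝ) ^ k * (runningIntegral^[k] X) t ω)
  | fractional (n : ℝ) (hn : 0 < n) : IsTypeIIIAverage X n (fun t ω =>
      1 / ((t : ℝ) ^ n * Real.Gamma n) *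
        ∫ s in (0 : ℝ)..t, (t - s) ^ (n - 1) * X s.toNNReal ω)

/-! ### The explicit Lévy densities for a Poisson process -/

/-- `λ Γ(n) 1_{(0,1]}(z) / Q(n, 1-z)^(n-1)` -/
def densityI (lam : ℝ≥0) (n : ℝ) : ℝ → ℝ :=
  (Ioc (0 : ℝ) 1).indicator fun z => lam * Real.Gamma n / inverseGammaQ n (1 - z) ^ (n - 1)

/-- `λ (-log z)^(n-1) 1_{(0,1]}(z) / Γ(n)` -/
def densityII (lam : ℝ≥0) (n : ℝ) : ℝ → ℝ :=
  (Ioc (0 : ℝ) 1).indicator fun z => lam * (-Real.log z) ^ (n - 1) / Real.Gamma n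

/-- `λ (Γ(n+1) z)^(1/n) 1_{(0,1/Γ(n+1)]}(z) / (n z)` -/
def densityIII (lam : ℝ≥0) (n : ℝ) : ℝ → ℝ :=
  (Ioc (0 : ℝ) (1 / Real.Gamma (n + 1))).indicator fun z =>
    lam * (Real.Gamma (n + 1) * z) ^ (1 / n) / (n * z)

/-- The law of `A_1` has Lévy density `ℓ`, vanishing outside `(0, b]`, and every Lévy process `W`
induced by `A` has Lévy density `ℓ` and is a compound Poisson process of jump intensity `lam`
whose jumps have law `ℓ(z) dz / lam`, concentrated on `(0, b]`. -/
def HasBoundedJumpDensity {Ω : Type u} [MeasurableSpace Ω] (A : ℝ≥0 → Ω → ℝ) (P : Measure Ω)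
    (lam : ℝ≥0) (ℓ : ℝ → ℝ) (b : ℝ) : Prop :=
  HasLevyMeasure (P.map (A 1)) (densityMeasure ℓ) ∧
  densityMeasure ℓ (Ioc 0 b)ᶜ = 0 ∧
  ∀ {Ω' : Type v} [MeasurableSpace Ω'] (W : ℝ≥0 → Ω' → ℝ) (Q : Measure Ω'),
    IsInducedClock A P W Q →
      HasLevyMeasure (Q.map (W 1)) (densityMeasure ℓ) ∧
      IsCompoundPoissonProcess W Q lam (densityMeasure fun z => ℓ z / lam)

end RegulatedClock

end

open RegulatedClock

noncomputable section

namespace RegulatedClock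

/-! ### Compound Poisson laws -/

/-! Types I and III. Both descriptions of the average are, path by path, `∫_0^1 X_{tv} g(v) dv` with
`g(v) = (-log v)^(n-1)/Γ(n)` or `g(v) = (1-v)^(n-1)/Γ(n)`; for integer degree this is Fubini on a
triangle (`IsTypeIAverage.eq_integral`, `IsTypeIIIAverage.eq_integral`). Integration by parts turns
the integral into `∫ G(v) dX_{tv}` with the tail `G(v) = ∫_v^1 g`, and independence of increments
gives the characteristic exponent `t ∫_0^1 ψ(ξ G(v)) dv`, where `ψ` is that of `X`
(`IsLevyProcess.charFun_weighted_integral`). For `ψ(ξ) = λ(e^{iξ} - 1)` this is the exponent of a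
compound Poisson law of rate `λt` whose jumps are distributed as `G(U)`, `U` uniform on `(0,1)`. As
`G` is strictly decreasing with derivative `-g`, the jump density at `z = G(v)` is `1/g(v)`
(`densityMeasure_eq_map_tail`). In type I, `G(v) = 1 - Γ(n, -log v)/Γ(n)`, so `-log v = Q(n, 1-z)`;
in type III, `G(v) = (1-v)^n/Γ(n+1)`.

Type II. Here the exponent itself is averaged. Running averages of `e^w` have Taylor coefficients
`1/(m!(m+1)^k)`, and so does the integral of `e^{wv}` against the logarithmic weight of degree `k`;
hence the integer recipe agrees with the fractional one and yields the hypergeometric series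
(`averagedExp_eq_integral`, `genHypergeometric_replicate`). The jump density is the logarithmic
weight.

In all cases the characteristic functions identify the laws as compound Poisson
(`laplace_and_hasBoundedJumpDensity_of_charFun`), and bounded jumps make the Laplace transform
available at every complex `u`. The type III transform is first obtained through the entire function
`entireLowerGamma`; its expression by incomplete gamma functions, on and off the branch cut, is
`Gamma_sub_complexUpperGamma`. -/

instance isProbabilityMeasure_convPow (ρ : Measure ℝ) [IsProbabilityMeasure ρ] (k : ℕ) :
    IsProbabilityMeasure (convPow ρ k) := by
  induction k with
  | zero => exact inferInstanceAs (IsProbabilityMeasure (Measure.dirac 0))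
  | succ k ih => exact inferInstanceAs (IsProbabilityMeasure ((convPow ρ k).conv ρ))

lemma convPow_succ (ρ : Measure ℝ) (k : ℕ) : convPow ρ (k + 1) = (convPow ρ k).conv ρ := rfl

lemma compoundPoissonLaw_eq_sum (r : ℝ≥0) (ρ : Measure ℝ) :
    compoundPoissonLaw r ρ = Measure.sum fun k : ℕ =>
      ENNReal.ofReal (Real.exp (-r) * r ^ k / (k ! : ℝ)) • convPow ρ k := by
  ext s hs
  rw [compoundPoissonLaw, Measure.bind_apply hs (by fun_prop), poissonMeasure,
    lintegral_sum_measure, Measure.sum_apply _ hs]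
  simp

instance isProbabilityMeasure_compoundPoissonLaw (r : ℝ≥0) (ρ : Measure ℝ)
    [IsProbabilityMeasure ρ] : IsProbabilityMeasure (compoundPoissonLaw r ρ) := by
  constructor
  rw [compoundPoissonLaw, Measure.bind_apply MeasurableSet.univ (by fun_prop)]
  simp

lemma integrable_exp_convPow {ρ : Measure ℝ} [IsProbabilityMeasure ρ] {w : ℂ}
    (h : Integrable (fun z : ℝ => Complex.exp (w * z)) ρ) (k : ℕ) :
    Integrable (fun z : ℝ => Complex.exp (w * z)) (convPow ρ k) := by
  induction k with
  | zero => exact integrable_dirac (by simp)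
  | succ k ih =>
    rw [convPow_succ, integrable_conv_iff (by fun_prop)]
    constructor
    · refine .of_forall fun x => ?_
      simp only [Complex.ofReal_add, mul_add, Complex.exp_add]
      exact h.const_mul _
    · simp only [Complex.ofReal_add, mul_add, Complex.exp_add, norm_mul, integral_const_mul]
      exact ih.norm.mul_const _

lemma integral_exp_convPow {ρ : Measure ℝ} [IsProbabilityMeasure ρ] {w : ℂ}
    (h : Integrable (fun z : ℝ => Complex.exp (w * z)) ρ) (k : ℕ) :
    ∫ z : ℝ, Complex.exp (w * z) ∂(convPow ρ k) = (∫ z : ℝ, Complex.exp (w * z) ∂ρ) ^ k := by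
  induction k with
  | zero => simp [convPow]
  | succ k ih =>
    rw [convPow_succ, integral_conv (by rw [← convPow_succ]; exact integrable_exp_convPow h _)]
    simp only [Complex.ofReal_add, mul_add, Complex.exp_add, integral_const_mul,
      integral_mul_const, ih, pow_succ]

/-- Absolute moments are needed to sum over the number of jumps: against Poisson weights they form
an exponential series. -/
lemma integral_norm_exp_convPow {ρ : Measure ℝ} [IsProbabilityMeasure ρ] {w : ℂ}
    (h : Integrable (fun z : ℝ => Complex.exp (w * z)) ρ) (k : ℕ) :
    ∫ z : ℝ, ‖Complex.exp (w * z)‖ ∂(convPow ρ k) = (∫ z : ℝ, ‖Complex.exp (w * z)‖ ∂ρ) ^ k := by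
  induction k with
  | zero => simp [convPow]
  | succ k ih =>
    rw [convPow_succ,
      integral_conv (by rw [← convPow_succ]; exact (integrable_exp_convPow h _).norm)]
    simp only [Complex.ofReal_add, mul_add, Complex.exp_add, norm_mul, integral_const_mul,
      integral_mul_const, ih, pow_succ]

/-- Conditionally on `k` jumps the transform is a `k`-th power, and the Poisson weights sum these
powers to an exponential. Real and imaginary `w` are treated together, integrability of `e^{wz}`
under the jump law being enough. -/
lemma integral_exp_compoundPoissonLaw (r : ℝ≥0) {ρ : Measure ℝ} [IsProbabilityMeasure ρ] {w : ℂ}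
    (h : Integrable (fun z : ℝ => Complex.exp (w * z)) ρ) :
    ∫ z : ℝ, Complex.exp (w * z) ∂(compoundPoissonLaw r ρ) =
      Complex.exp (r * ((∫ z : ℝ, Complex.exp (w * z) ∂ρ) - 1)) := by
  have hpos (k : ℕ) : 0 ≤ Real.exp (-r) * r ^ k / (k ! : ℝ) := by positivity
  have hint : Integrable (fun z : ℝ => Complex.exp (w * z)) (Measure.sum fun k : ℕ =>
      ENNReal.ofReal (Real.exp (-r) * r ^ k / (k ! : ℝ)) • convPow ρ k) := by
    refine integrable_sum_measure
      (fun k => (integrable_exp_convPow h k).smul_measure ENNReal.ofReal_ne_top) ?_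
    simp only [integral_smul_measure, integral_norm_exp_convPow h,
      ENNReal.toReal_ofReal (hpos _)]
    convert! (Real.summable_pow_div_factorial
      (r * ∫ z : ℝ, ‖Complex.exp (w * z)‖ ∂ρ)).mul_left (Real.exp (-r)) using 2 with k
    rw [mul_pow, smul_eq_mul]
    ring
  rw [compoundPoissonLaw_eq_sum]
  refine (hasSum_integral_measure hint).unique ?_
  simp only [integral_smul_measure, integral_exp_convPow h, ENNReal.toReal_ofReal (hpos _)]
  have := (NormedSpace.expSeries_div_hasSum_exp
    ((r : ℂ) * ∫ z : ℝ, Complex.exp (w * z) ∂ρ)).mul_left (Complex.exp (-r))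
  rw [← Complex.exp_eq_exp_ℂ, ← Complex.exp_add] at this
  convert! this using 2 with k
  · rw [mul_pow, Complex.real_smul]
    push_cast
    ring
  · ring

lemma charFun_compoundPoissonLaw (r : ℝ≥0) (ρ : Measure ℝ) [IsProbabilityMeasure ρ] (ξ : ℝ) :
    charFun (compoundPoissonLaw r ρ) ξ = Complex.exp (r * (charFun ρ ξ - 1)) := by
  have key (x : ℝ) : Complex.exp ((ξ * Complex.I) * x) = Complex.exp (ξ * x * Complex.I) := by
    ring_nf
  have h : Integrable (fun z : ℝ => Complex.exp ((ξ * Complex.I) * z)) ρ := by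
    refine Integrable.of_bound (by fun_prop) 1 (.of_forall fun x => ?_)
    rw [key, ← Complex.ofReal_mul, Complex.norm_exp_ofReal_mul_I]
  simpa only [key, ← charFun_apply_real] using integral_exp_compoundPoissonLaw r h

/-! ### Lévy densities from characteristic functions -/

lemma densityMeasure_eq_smul {lam : ℝ≥0} (hlam : 0 < lam) (ℓ : ℝ → ℝ) :
    densityMeasure ℓ = lam • densityMeasure fun z => ℓ z / lam := by
  change _ = (lam : ℝ≥0∞) • densityMeasure fun z => ℓ z / lam
  rw [densityMeasure, densityMeasure, ← withDensity_smul' _ _ ENNReal.coe_ne_top]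
  congr 1
  ext z
  rw [Pi.smul_apply, smul_eq_mul, ← ENNReal.ofReal_coe_nnreal, ← ENNReal.ofReal_mul (by simp),
    mul_div_cancel₀ _ (by exact_mod_cast hlam.ne')]

lemma integrable_exp_of_bounded_support {ρ : Measure ℝ} [IsFiniteMeasure ρ] {b : ℝ}
    (hb : ρ (Ioc 0 b)ᶜ = 0) (w : ℂ) : Integrable (fun z : ℝ => Complex.exp (w * z)) ρ := by
  refine Integrable.of_bound (by fun_prop) (Real.exp (‖w‖ * b)) ?_
  filter_upwards [show ∀ᵐ x ∂ρ, x ∈ Ioc 0 b from hb] with x hx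
  refine (Complex.norm_exp_le_exp_norm _).trans (Real.exp_le_exp.2 ?_)
  rw [norm_mul, Complex.norm_real, Real.norm_of_nonneg hx.1.le]
  gcongr
  exact hx.2

lemma hasLevyMeasure_compoundPoissonLaw {lam : ℝ≥0} (hlam : 0 < lam) {ℓ : ℝ → ℝ} {b : ℝ}
    [IsProbabilityMeasure (densityMeasure fun z => ℓ z / lam)]
    (hb : densityMeasure (fun z => ℓ z / lam) (Ioc 0 b)ᶜ = 0) :
    HasLevyMeasure (compoundPoissonLaw lam (densityMeasure fun z => ℓ z / lam))
      (densityMeasure ℓ) := by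
  set ρ := densityMeasure fun z => ℓ z / lam with hρ
  rw [densityMeasure_eq_smul hlam, ← hρ]
  refine ⟨?_, ?_, fun u _ => ?_⟩
  · have : ρ (Iic 0) = 0 :=
      measure_mono_null (fun x (hx : x ≤ 0) (h : x ∈ Ioc 0 b) => h.1.not_ge hx) hb
    simp [this]
  · refine (lintegral_mono (g := fun _ => 1) fun z => ?_).trans_lt ?_
    · simp
    · simp
  · have h := integrable_exp_of_bounded_support hb (-u)
    rw [integral_exp_compoundPoissonLaw lam h, integral_smul_nnreal_measure,
      integral_sub h (by simp)]
    simp [NNReal.smul_def]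

/-- A process whose one-dimensional laws have the characteristic functions of compound Poisson
laws with bounded positive jumps. -/
theorem laplace_and_hasBoundedJumpDensity_of_charFun {Ω : Type u} [MeasurableSpace Ω]
    {A : ℝ≥0 → Ω → ℝ} {P : Measure Ω} [IsProbabilityMeasure P] {lam : ℝ≥0} (hlam : 0 < lam)
    {ℓ : ℝ → ℝ} {b : ℝ} (hA : ∀ t, AEMeasurable (A t) P)
    (hρ : IsProbabilityMeasure (densityMeasure fun z => ℓ z / lam))
    (hb : densityMeasure (fun z => ℓ z / lam) (Ioc 0 b)ᶜ = 0)
    (hchar : ∀ (t : ℝ≥0) (ξ : ℝ), charFun (P.map (A t)) ξ =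
      Complex.exp (lam * t * (charFun (densityMeasure fun z => ℓ z / lam) ξ - 1))) :
    (∀ u : ℂ, laplace (A 1) P u = Complex.exp (lam *
      ((∫ z : ℝ, Complex.exp (-u * z) ∂(densityMeasure fun z => ℓ z / lam)) - 1))) ∧
    HasBoundedJumpDensity.{u, v} A P lam ℓ b := by
  -- Characteristic functions determine the law, so every remaining claim is read off from the
  -- compound Poisson law.
  have hlaw (t : ℝ≥0) :
      P.map (A t) = compoundPoissonLaw (lam * t) (densityMeasure fun z => ℓ z / lam) := by
    have := Measure.isProbabilityMeasure_map (hA t)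
    refine Measure.ext_of_charFun (funext fun ξ => ?_)
    rw [hchar, charFun_compoundPoissonLaw]
    push_cast
    rfl
  have hlevy := hasLevyMeasure_compoundPoissonLaw hlam hb
  refine ⟨fun u => ?_, ?_, ?_, fun W Q hW => ⟨?_, hW.1, hρ, ?_, fun t => ?_⟩⟩
  · rw [← integral_exp_compoundPoissonLaw lam (integrable_exp_of_bounded_support hb (-u)),
      show compoundPoissonLaw lam _ = P.map (A 1) by rw [hlaw, mul_one],
      integral_map (hA 1) (by fun_prop)]
    rfl
  · rwa [hlaw, mul_one]
  · rw [densityMeasure_eq_smul hlam]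
    simp [hb]
  · rwa [(hW.2 1).map_eq, hlaw, mul_one]
  · exact measure_mono_null (by simp) hb
  · rw [(hW.2 t).map_eq, hlaw]

/-! ### Integrals of nondecreasing Lévy processes -/

/-- The almost sure properties of the paths of a nondecreasing Lévy process. -/
structure IsSubordinatorPath (x : ℝ≥0 → ℝ) : Prop where
  zero : x 0 = 0
  mono : Monotone x
  rightCont : ∀ t, ContinuousWithinAt x (Ici t) t

lemma tendsto_ceil_mul_div_nat {a : ℝ} (ha : 0 ≤ a) :
    Tendsto (fun N : ℕ => (⌈a * N⌉₊ : ℝ) / N) atTop (𝓝 a) :=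
  (tendsto_nat_ceil_mul_div_atTop ha).comp tendsto_natCast_atTop_atTop

lemma le_ceil_mul_div_nat (a : ℝ) {N : ℕ} (hN : N ≠ 0) : a ≤ (⌈a * N⌉₊ : ℝ) / N := by
  rw [le_div_iff₀ (by positivity)]
  exact Nat.le_ceil _

/-- Times are rounded up, so that the grid points approach from the right, the only side on which
the path is continuous. -/
lemma tendsto_rightCont_ceil {x : ℝ≥0 → ℝ} {t : ℝ≥0} {a : ℝ} (ha : 0 ≤ a)
    (hx : ContinuousWithinAt x (Ici (t * a.toNNReal)) (t * a.toNNReal)) :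
    Tendsto (fun N : ℕ => x (t * ((⌈a * N⌉₊ : ℝ) / N).toNNReal)) atTop
      (𝓝 (x (t * a.toNNReal))) := by
  refine hx.tendsto.comp (tendsto_nhdsWithin_iff.2 ⟨?_, ?_⟩)
  · exact ((continuous_real_toNNReal.tendsto _).comp (tendsto_ceil_mul_div_nat ha)).const_mul t
  · filter_upwards [eventually_ne_atTop 0] with N hN
    exact mul_le_mul_right (Real.toNNReal_mono (le_ceil_mul_div_nat a hN)) t

section Levy

variable {Ω : Type u} [MeasurableSpace Ω] {Y : ℝ≥0 → Ω → ℝ} {P : Measure Ω}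

lemma IsLevyProcess.identDistrib_increment (hY : IsLevyProcess Y P) (s h : ℝ≥0) :
    IdentDistrib (fun ω => Y (s + h) ω - Y s ω) (Y h) P P := by
  refine (hY.stationary s h).trans (IdentDistrib.of_ae_eq ?_ ?_)
  · exact ((hY.measurable h).sub (hY.measurable 0)).aemeasurable
  · filter_upwards [hY.zero] with ω hω
    simp [hω]

/-- An increment has the law of some `Y h`, so it is almost surely nonnegative. This holds
simultaneously for the countably many pairs of rational grid times and passes to all times by right
continuity. -/
lemma IsLevyProcess.ae_isSubordinatorPath (hY : IsLevyProcess Y P)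
    (hnn : ∀ t, ∀ᵐ ω ∂P, 0 ≤ Y t ω) : ∀ᵐ ω ∂P, IsSubordinatorPath fun t => Y t ω := by
  have hinc (s h : ℝ≥0) : ∀ᵐ ω ∂P, Y s ω ≤ Y (s + h) ω := by
    filter_upwards [(hY.identDistrib_increment s h).symm.ae_mem_snd measurableSet_Ici (hnn h)]
      with ω hω
    exact sub_nonneg.1 hω
  have hgrid : ∀ᵐ ω ∂P, ∀ N i j : ℕ, Y ((i : ℝ) / N).toNNReal ω ≤
      Y (((i : ℝ) / N).toNNReal + ((j : ℝ) / N).toNNReal) ω := by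
    simp only [ae_all_iff]
    exact fun _ _ _ => hinc _ _
  filter_upwards [hgrid, hY.zero, hY.cadlag] with ω hω h0 hc
  refine ⟨h0, fun s t hst => ?_, fun t => (hc t).1⟩
  have key (r : ℝ≥0) := tendsto_rightCont_ceil (x := fun t => Y t ω) (t := 1) (a := r) r.2
    (by simpa using (hc r).1)
  simp only [one_mul, Real.toNNReal_coe] at key
  refine le_of_tendsto_of_tendsto' (key s) (key t) fun N => ?_
  have hle : ⌈(s : ℝ) * N⌉₊ ≤ ⌈(t : ℝ) * N⌉₊ := Nat.ceil_mono (by gcongr)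
  obtain ⟨j, hj⟩ := Nat.exists_eq_add_of_le hle
  have := hω N ⌈(s : ℝ) * N⌉₊ j
  rwa [← Real.toNNReal_add (by positivity) (by positivity), ← add_div, ← Nat.cast_add,
    ← hj] at this

end Levy

namespace IsSubordinatorPath

variable {x : ℝ≥0 → ℝ}

lemma nonneg (hx : IsSubordinatorPath x) (t : ℝ≥0) : 0 ≤ x t := hx.zero ▸ hx.mono zero_le

lemma monotone_toNNReal (hx : IsSubordinatorPath x) (t : ℝ≥0) :
    Monotone fun v : ℝ => x (t * v.toNNReal) :=
  fun _ _ h => hx.mono (mul_le_mul_right (Real.toNNReal_mono h) t)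

lemma norm_le (hx : IsSubordinatorPath x) (t : ℝ≥0) {v : ℝ} (hv : v ≤ 1) :
    ‖x (t * v.toNNReal)‖ ≤ x t := by
  rw [Real.norm_of_nonneg (hx.nonneg _)]
  exact hx.mono (mul_le_of_le_one_right' (by simpa using hv))

end IsSubordinatorPath

/-! ### Riemann and Riemann–Stieltjes sums on the grid `i/N`. -/

lemma ceil_mul_eq_of_mem_Ioc {N i : ℕ} (hN : N ≠ 0) {v : ℝ}
    (hv : v ∈ Ioc ((i : ℝ) / N) (((i + 1 : ℕ) : ℝ) / N)) : ⌈v * N⌉₊ = i + 1 := by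
  have hN' : (0 : ℝ) < N := by positivity
  rw [Nat.ceil_eq_iff (by simp)]
  exact ⟨by simpa using (div_lt_iff₀ hN').1 hv.1, (le_div_iff₀ hN').1 hv.2⟩

/-- Grid sums become integrals over the fixed interval `[0,1]`, to which dominated convergence
applies. The target `E` is general because real paths and complex exponents are both sampled in this
way. -/
lemma integral_smul_step {E : Type*} [NormedAddCommGroup E] [NormedSpace ℝ E]
    [CompleteSpace E] (c : ℕ → E)
    {g : ℝ → ℝ} (hg : IntervalIntegrable g volume 0 1) {N : ℕ} (hN : N ≠ 0) :
    ∫ v in (0 : ℝ)..1, g v • c ⌈v * N⌉₊ = ∑ i ∈ Finset.range N,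
      (∫ v in ((i : ℝ) / N)..(((i + 1 : ℕ) : ℝ) / N), g v) • c (i + 1) := by
  have hle (i : ℕ) : (i : ℝ) / N ≤ ((i + 1 : ℕ) : ℝ) / N := by gcongr; simp
  have hgi (i : ℕ) (hi : i < N) :
      IntervalIntegrable g volume ((i : ℝ) / N) (((i + 1 : ℕ) : ℝ) / N) := by
    refine hg.mono_set ?_
    rw [uIcc_of_le (hle i), uIcc_of_le zero_le_one]
    refine Icc_subset_Icc (by positivity) ?_
    rw [div_le_one (by positivity)]
    exact_mod_cast hi
  have hcongr (i : ℕ) : EqOn (fun v => g v • c (i + 1)) (fun v => g v • c ⌈v * N⌉₊)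
      (Ioc ((i : ℝ) / N) (((i + 1 : ℕ) : ℝ) / N)) := fun v hv => by
    simp only [ceil_mul_eq_of_mem_Ioc hN hv]
  have h := intervalIntegral.sum_integral_adjacent_intervals (μ := volume)
    (f := fun v => g v • c ⌈v * N⌉₊) (a := fun i : ℕ => (i : ℝ) / N) (n := N) fun i hi => by
      have := hgi i hi
      rw [intervalIntegrable_iff_integrableOn_Ioc_of_le (hle i)] at this ⊢
      exact IntegrableOn.congr_fun (this.smul_const (c (i + 1))) (hcongr i) measurableSet_Ioc
  rw [Nat.cast_zero, zero_div, div_self (by exact_mod_cast hN)] at h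
  rw [← h]
  refine Finset.sum_congr rfl fun i hi => ?_
  rw [← intervalIntegral.integral_smul_const, intervalIntegral.integral_of_le (hle i),
    intervalIntegral.integral_of_le (hle i)]
  exact (setIntegral_congr_fun measurableSet_Ioc (hcongr i)).symm

/-- Abel summation; both boundary terms vanish, since the path starts at `0` and the tail of the
weight vanishes at `1`. -/
lemma sum_by_parts (y G : ℕ → ℝ) (N : ℕ) (h0 : y 0 = 0) (hN : G N = 0) :
    ∑ i ∈ Finset.range N, (y (i + 1) - y i) * G i =
      ∑ i ∈ Finset.range N, (G i - G (i + 1)) * y (i + 1) := by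
  have (M : ℕ) : ∑ i ∈ Finset.range M, (y (i + 1) - y i) * G i = y M * G M - y 0 * G 0 +
      ∑ i ∈ Finset.range M, (G i - G (i + 1)) * y (i + 1) := by
    induction M with
    | zero => simp
    | succ M ih => rw [Finset.sum_range_succ, Finset.sum_range_succ, ih]; ring
  simp [this, h0, hN]

/-- Riemann–Stieltjes sums of a subordinator path. -/
lemma IsSubordinatorPath.tendsto_sum {x : ℝ≥0 → ℝ} (hx : IsSubordinatorPath x) (t : ℝ≥0)
    {g : ℝ → ℝ} (hg : IntervalIntegrable g volume 0 1) :
    Tendsto (fun N : ℕ => ∑ i ∈ Finset.range N,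
      (x (t * (((i + 1 : ℕ) : ℝ) / N).toNNReal) - x (t * ((i : ℝ) / N).toNNReal)) *
        ∫ v in ((i : ℝ) / N)..1, g v) atTop (𝓝 (∫ v in (0 : ℝ)..1, x (t * v.toNNReal) * g v)) := by
  -- After Abel summation the sum is the integral of `g` against the path sampled at the right end
  -- of each cell. Monotonicity bounds the sampled path by `x t`, which gives the dominating
  -- function.
  have hlim : Tendsto (fun N : ℕ => ∫ v in (0 : ℝ)..1,
      g v • x (t * ((⌈v * N⌉₊ : ℝ) / N).toNNReal)) atTop
      (𝓝 (∫ v in (0 : ℝ)..1, g v • x (t * v.toNNReal))) := by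
    refine intervalIntegral.tendsto_integral_filter_of_dominated_convergence
      (fun v => ‖g v‖ * x t) ?_ ?_ (hg.norm.mul_const _) ?_
    · refine .of_forall fun N => AEStronglyMeasurable.fun_smul ?_ ?_
      · exact (intervalIntegrable_iff.1 hg).aestronglyMeasurable
      · refine Measurable.aestronglyMeasurable (((hx.monotone_toNNReal t).measurable).comp ?_)
        fun_prop
    · filter_upwards [eventually_ne_atTop 0] with N hN
      refine .of_forall fun v hv => ?_
      rw [uIoc_of_le zero_le_one] at hv
      rw [norm_smul]
      refine mul_le_mul_of_nonneg_left (hx.norm_le t ?_) (norm_nonneg _)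
      rw [div_le_one (by positivity), Nat.cast_le, Nat.ceil_le]
      exact mul_le_of_le_one_left (by positivity) hv.2
    · refine .of_forall fun v hv => ?_
      rw [uIoc_of_le zero_le_one] at hv
      exact (tendsto_rightCont_ceil hv.1.le (hx.rightCont _)).const_smul _
  simp only [mul_comm _ (g _)]
  refine hlim.congr' ?_
  filter_upwards [eventually_ne_atTop 0] with N hN
  rw [integral_smul_step (fun j => x (t * ((j : ℝ) / N).toNNReal)) hg hN,
    sum_by_parts (fun i => x (t * ((i : ℝ) / N).toNNReal)) (fun i => ∫ v in ((i : ℝ) / N)..1, g v)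
      N (by simp [hx.zero]) (by rw [div_self (by exact_mod_cast hN)]; simp)]
  refine Finset.sum_congr rfl fun i hi => ?_
  have hi' : ((i + 1 : ℕ) : ℝ) / N ≤ 1 := by
    rw [div_le_one (by positivity)]
    exact_mod_cast Finset.mem_range.1 hi
  have hle : (i : ℝ) / N ≤ ((i + 1 : ℕ) : ℝ) / N := by gcongr; simp
  have h1 : IntervalIntegrable g volume ((i : ℝ) / N) 1 := hg.mono_set (by
    rw [uIcc_of_le (hle.trans hi'), uIcc_of_le zero_le_one]
    exact Icc_subset_Icc (by positivity) le_rfl)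
  have h2 : IntervalIntegrable g volume (((i + 1 : ℕ) : ℝ) / N) 1 := hg.mono_set (by
    rw [uIcc_of_le hi', uIcc_of_le zero_le_one]
    exact Icc_subset_Icc (by positivity) le_rfl)
  rw [smul_eq_mul]
  congr 1
  rw [← intervalIntegral.integral_add_adjacent_intervals (h1.trans h2.symm) h2]
  ring

/-- Riemann sums for the characteristic exponent. -/
lemma tendsto_sum_exponent {ψ : ℝ → ℂ} (hψ : Continuous ψ) {g : ℝ → ℝ}
    (hg : IntervalIntegrable g volume 0 1) (ξ : ℝ) :
    Tendsto (fun N : ℕ => ∑ i ∈ Finset.range N,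
      ((1 / N : ℝ) : ℂ) * ψ (ξ * ∫ v in ((i : ℝ) / N)..1, g v)) atTop
      (𝓝 (∫ v in (0 : ℝ)..1, ψ (ξ * ∫ w in v..1, g w))) := by
  have hGc : ContinuousOn (fun v => ∫ w in v..1, g w) (Icc 0 1) := by
    have := intervalIntegral.continuousOn_primitive_interval_left
      (f := g) (μ := volume) (a := 0) (b := 1)
      (by rwa [uIcc_of_le zero_le_one, integrableOn_Icc_iff_integrableOn_Ioc,
        ← intervalIntegrable_iff_integrableOn_Ioc_of_le zero_le_one])
    rwa [uIcc_of_le zero_le_one] at this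
  have hH : ContinuousOn (fun v => ψ (ξ * ∫ w in v..1, g w)) (Icc 0 1) :=
    hψ.comp_continuousOn (hGc.const_mul ξ)
  obtain ⟨C, hC⟩ := isCompact_Icc.exists_bound_of_continuousOn hH
  -- The point `(⌈vN⌉ - 1)/N` is the left end of the cell containing `v`, where the tail is
  -- evaluated in the Stieltjes sums.
  have hmem {v : ℝ} (hv : v ∈ Ioc (0 : ℝ) 1) {N : ℕ} (hN : N ≠ 0) :
      ((⌈v * N⌉₊ : ℝ) - 1) / N ∈ Icc (0 : ℝ) 1 := by
    have hN' : (0 : ℝ) < N := by positivity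
    constructor
    · refine div_nonneg ?_ hN'.le
      rw [sub_nonneg, Nat.one_le_cast]
      exact Nat.one_le_ceil_iff.2 (mul_pos hv.1 hN')
    · rw [div_le_one hN', sub_le_iff_le_add]
      have := Nat.ceil_lt_add_one (mul_nonneg hv.1.le hN'.le)
      nlinarith [hv.2]
  have hlim : Tendsto (fun N : ℕ => ∫ v in (0 : ℝ)..1,
      (1 : ℝ) • ψ (ξ * ∫ w in (((⌈v * N⌉₊ : ℝ) - 1) / N)..1, g w)) atTop
      (𝓝 (∫ v in (0 : ℝ)..1, ψ (ξ * ∫ w in v..1, g w))) := by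
    refine intervalIntegral.tendsto_integral_filter_of_dominated_convergence
      (fun v => C) ?_ ?_ (by simp) ?_
    · refine .of_forall fun N => Measurable.aestronglyMeasurable ?_
      have : Measurable fun j : ℕ => (1 : ℝ) • ψ (ξ * ∫ w in (((j : ℝ) - 1) / N)..1, g w) :=
        measurable_from_nat
      exact this.comp (by fun_prop : Measurable fun v : ℝ => ⌈v * N⌉₊)
    · filter_upwards [eventually_ne_atTop 0] with N hN
      refine .of_forall fun v hv => ?_
      rw [uIoc_of_le zero_le_one] at hv
      rw [one_smul]
      exact hC _ (hmem hv hN)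
    · refine .of_forall fun v hv => ?_
      rw [uIoc_of_le zero_le_one] at hv
      simp only [one_smul]
      refine (hH v (Ioc_subset_Icc_self hv)).tendsto.comp (tendsto_nhdsWithin_iff.2 ⟨?_, ?_⟩)
      · have h1 := (tendsto_ceil_mul_div_nat hv.1.le).sub
          (tendsto_const_div_atTop_nhds_zero_nat (𝕜 := ℝ) 1)
        rw [sub_zero] at h1
        exact h1.congr fun N => (sub_div _ _ _).symm
      · filter_upwards [eventually_ne_atTop 0] with N hN using hmem hv hN
  refine hlim.congr' ?_
  filter_upwards [eventually_ne_atTop 0] with N hN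
  rw [integral_smul_step (fun j => ψ (ξ * ∫ w in (((j : ℝ) - 1) / N)..1, g w))
    (g := fun _ => (1 : ℝ)) (by simp) hN]
  refine Finset.sum_congr rfl fun i hi => ?_
  have : ((i + 1 : ℕ) : ℝ) / N - (i : ℝ) / N = 1 / N := by push_cast; ring
  rw [intervalIntegral.integral_const, this, smul_eq_mul, mul_one, Complex.real_smul]
  push_cast
  rw [add_sub_cancel_right]

section Levy

variable {Ω : Type u} [MeasurableSpace Ω] {Y : ℝ≥0 → Ω → ℝ} {P : Measure Ω}

/-- The increments over the grid are independent and each covers a time `t/N`, so each contributes a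
factor `exp((t/N) ψ(ξ c_i))`. -/
lemma IsLevyProcess.charFun_sum_increment (hY : IsLevyProcess Y P) {ψ : ℝ → ℂ}
    (hchar : ∀ (t : ℝ≥0) (ξ : ℝ), charFun (P.map (Y t)) ξ = Complex.exp (t * ψ ξ))
    (t : ℝ≥0) (c : ℕ → ℝ) {N : ℕ} (hN : N ≠ 0) (ξ : ℝ) :
    charFun (P.map fun ω => ∑ i ∈ Finset.range N,
      (Y (t * (((i + 1 : ℕ) : ℝ) / N).toNNReal) ω - Y (t * ((i : ℝ) / N).toNNReal) ω) * c i) ξ =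
    Complex.exp (t * ∑ i ∈ Finset.range N, ((1 / N : ℝ) : ℂ) * ψ (ξ * c i)) := by
  have hmono : Monotone fun i : ℕ => t * ((i : ℝ) / N).toNNReal := fun i j hij =>
    mul_le_mul_right (Real.toNNReal_mono (by gcongr)) t
  have hind := (hY.indep.nat hmono).comp (fun i r => r * c i) fun i => by fun_prop
  have hres := hind.precomp (Subtype.val_injective (p := (· ∈ Finset.range N)))
  have := hY.measurable
  rw [iIndepFun.charFun_map_fun_finsetSum_eq_prod (X := fun i ω =>
      (Y (t * (((i + 1 : ℕ) : ℝ) / N).toNNReal) ω - Y (t * ((i : ℝ) / N).toNNReal) ω) * c i)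
      (fun i _ => by fun_prop) hres,
    Finset.prod_apply, Finset.mul_sum, Complex.exp_sum]
  refine Finset.prod_congr rfl fun i _ => ?_
  have hstep : t * (((i + 1 : ℕ) : ℝ) / N).toNNReal =
      t * ((i : ℝ) / N).toNNReal + t * (1 / N : ℝ).toNNReal := by
    rw [← mul_add, ← Real.toNNReal_add (by positivity) (by positivity)]
    congr 2
    push_cast
    ring
  simp only [mul_comm _ (c i), hstep]
  rw [charFun_map_mul_comp (by fun_prop), (hY.identDistrib_increment _ _).map_eq, hchar]
  congr 1
  rw [NNReal.coe_mul, Real.coe_toNNReal _ (by positivity)]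
  push_cast
  ring

/-- The law of a weighted integral of the path of a nondecreasing Lévy process. -/
theorem IsLevyProcess.charFun_weighted_integral (hY : IsLevyProcess Y P)
    (hnn : ∀ t, ∀ᵐ ω ∂P, 0 ≤ Y t ω) {ψ : ℝ → ℂ} (hψ : Continuous ψ)
    (hchar : ∀ (t : ℝ≥0) (ξ : ℝ), charFun (P.map (Y t)) ξ = Complex.exp (t * ψ ξ))
    {g : ℝ → ℝ} (hg : IntervalIntegrable g volume 0 1) (t : ℝ≥0) :
    AEMeasurable (fun ω => ∫ v in (0 : ℝ)..1, Y (t * v.toNNReal) ω * g v) P ∧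
    ∀ ξ : ℝ, charFun (P.map fun ω => ∫ v in (0 : ℝ)..1, Y (t * v.toNNReal) ω * g v) ξ =
      Complex.exp (t * ∫ v in (0 : ℝ)..1, ψ (ξ * ∫ w in v..1, g w)) := by
  have := hY.isProbabilityMeasure
  have hYm := hY.measurable
  set S : ℕ → Ω → ℝ := fun N ω => ∑ i ∈ Finset.range N,
    (Y (t * (((i + 1 : ℕ) : ℝ) / N).toNNReal) ω - Y (t * ((i : ℝ) / N).toNNReal) ω) *
      ∫ v in ((i : ℝ) / N)..1, g v with hS
  have hSm (N : ℕ) : Measurable (S N) := by fun_prop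
  -- This almost sure limit supplies both the measurability of the integral and, by dominated
  -- convergence, the limit of the characteristic functions.
  have hlim : ∀ᵐ ω ∂P, Tendsto (fun N => S N ω) atTop
      (𝓝 (∫ v in (0 : ℝ)..1, Y (t * v.toNNReal) ω * g v)) := by
    filter_upwards [hY.ae_isSubordinatorPath hnn] with ω hω using hω.tendsto_sum t hg
  have hAm := aemeasurable_of_tendsto_metrizable_ae atTop (fun N => (hSm N).aemeasurable) hlim
  refine ⟨hAm, fun ξ => ?_⟩
  have hnorm (x : ℝ) : ‖Complex.exp (ξ * x * Complex.I)‖ = 1 := by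
    rw [← Complex.ofReal_mul, Complex.norm_exp_ofReal_mul_I]
  have h1 : Tendsto (fun N => charFun (P.map (S N)) ξ) atTop (𝓝 (charFun (P.map fun ω =>
      ∫ v in (0 : ℝ)..1, Y (t * v.toNNReal) ω * g v) ξ)) := by
    simp only [charFun_apply_real]
    rw [integral_map hAm (by fun_prop)]
    simp only [integral_map (hSm _).aemeasurable (f := fun x : ℝ => Complex.exp (ξ * x * Complex.I))
      (by fun_prop)]
    refine tendsto_integral_of_dominated_convergence (fun _ => 1) (fun N => ?_) (by simp) ?_ ?_
    · have := hSm N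
      fun_prop
    · exact fun N => .of_forall fun ω => (hnorm _).le
    · filter_upwards [hlim] with ω hω
      have hc : Continuous fun x : ℝ => Complex.exp (ξ * x * Complex.I) := by fun_prop
      exact (hc.tendsto _).comp hω
  refine tendsto_nhds_unique h1 (Tendsto.congr' ?_
    ((Complex.continuous_exp.tendsto _).comp ((tendsto_sum_exponent hψ hg ξ).const_mul (t : ℂ))))
  filter_upwards [eventually_ne_atTop 0] with N hN
  exact (hY.charFun_sum_increment hchar t _ hN ξ).symm

end Levy

/-! ### The logarithmic weight -/

lemma image_exp_neg_Ioi (a : ℝ) :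
    (fun y : ℝ => Real.exp (-y)) '' Ioi a = Ioo 0 (Real.exp (-a)) := by
  ext v
  constructor
  · rintro ⟨y, hy, rfl⟩
    exact ⟨Real.exp_pos _, Real.exp_lt_exp.2 (neg_lt_neg hy)⟩
  · rintro ⟨h0, h1⟩
    refine ⟨-Real.log v, ?_, by simp [Real.exp_log h0]⟩
    have := (Real.log_lt_iff_lt_exp h0).2 h1
    exact lt_neg_of_lt_neg this

lemma hasDerivWithinAt_exp_neg (s : Set ℝ) (y : ℝ) :
    HasDerivWithinAt (fun y : ℝ => Real.exp (-y)) (-Real.exp (-y)) s y := by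
  simpa using ((hasDerivAt_neg y).exp).hasDerivWithinAt

lemma injOn_exp_neg (s : Set ℝ) : InjOn (fun y : ℝ => Real.exp (-y)) s :=
  fun _ _ _ _ h => neg_injective (Real.exp_injective h)

/-- The substitution `v = e^{-y}` turns the logarithmic weight into the gamma integrand; no
integrability of `f` is required. -/
lemma setIntegral_comp_neg_log {E : Type*} [NormedAddCommGroup E] [NormedSpace ℝ E] (f : ℝ → E)
    (a : ℝ) :
    ∫ v in Ioo 0 (Real.exp (-a)), f (-Real.log v) = ∫ y in Ioi a, Real.exp (-y) • f y := by
  rw [← image_exp_neg_Ioi, integral_image_eq_integral_abs_deriv_smul measurableSet_Ioi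
    (fun y _ => hasDerivWithinAt_exp_neg _ y) (injOn_exp_neg _)]
  simp

lemma intervalIntegrable_neg_log_rpow {n : ℝ} (hn : 0 < n) :
    IntervalIntegrable (fun v => (-Real.log v) ^ (n - 1)) volume 0 1 := by
  rw [intervalIntegrable_iff_integrableOn_Ioo_of_le zero_le_one]
  have h := image_exp_neg_Ioi 0
  rw [neg_zero, Real.exp_zero] at h
  rw [← h, integrableOn_image_iff_integrableOn_abs_deriv_smul measurableSet_Ioi
    (fun y _ => hasDerivWithinAt_exp_neg _ y) (injOn_exp_neg _)]
  simpa using Real.GammaIntegral_convergent hn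

lemma setIntegral_neg_log_rpow (n a : ℝ) :
    ∫ v in Ioo 0 (Real.exp (-a)), (-Real.log v) ^ (n - 1) = upperGamma n a := by
  rw [setIntegral_comp_neg_log (fun y => y ^ (n - 1))]
  simp only [smul_eq_mul, mul_comm]
  rfl

lemma integral_neg_log_rpow {n : ℝ} (hn : 0 < n) :
    ∫ v in (0 : ℝ)..1, (-Real.log v) ^ (n - 1) = Real.Gamma n := by
  have := setIntegral_neg_log_rpow n 0
  rw [neg_zero, Real.exp_zero] at this
  rw [intervalIntegral.integral_of_le zero_le_one, integral_Ioc_eq_integral_Ioo, this, upperGamma,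
    Real.Gamma_eq_integral hn]
  simp only [mul_comm]

/-! ### Iterated averages and integrals of a path -/

/-- Fubini's theorem on the triangle `0 < r < w ≤ 1`, for a nonnegative kernel and a bounded
integrand. -/
lemma integral_triangle_swap {h : ℝ → ℝ → ℝ} (hm : Measurable (Function.uncurry h))
    (hnn : ∀ w ≤ 1, ∀ r ∈ Ioo 0 w, 0 ≤ h w r) {H : ℝ → ℝ}
    (hint : ∀ r ∈ Ioo (0 : ℝ) 1, IntervalIntegrable (fun w => h w r) volume r 1)
    (hH : ∀ r ∈ Ioo (0 : ℝ) 1, ∫ w in r..1, h w r = H r) (hHint : IntervalIntegrable H volume 0 1)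
    {y : ℝ → ℝ} (hy : Measurable y) {C : ℝ} (hC : ∀ v ≤ 1, ‖y v‖ ≤ C) :
    ∫ w in (0 : ℝ)..1, ∫ r in (0 : ℝ)..w, y r * h w r = ∫ r in (0 : ℝ)..1, y r * H r := by
  set μ : Measure ℝ := volume.restrict (Ioo 0 1) with hμ
  -- The kernel is extended by zero off the triangle, so that Fubini applies on the unit square.
  set K : ℝ → ℝ → ℝ := fun w r => if r < w then h w r else 0 with hK
  have hKm : Measurable (Function.uncurry K) :=
    Measurable.ite (measurableSet_lt measurable_snd measurable_fst) hm measurable_const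
  have hslice {r : ℝ} (hr : r ∈ Ioo (0 : ℝ) 1) :
      (fun w => K w r) =ᵐ[μ] (Ioo r 1).indicator fun w => h w r := by
    filter_upwards [ae_restrict_mem measurableSet_Ioo] with w hw
    by_cases hrw : r < w
    · simp [hK, hrw, hw.2]
    · simp [hK, hrw]
  have hset {r : ℝ} (hr : r ∈ Ioo (0 : ℝ) 1) :
      μ.restrict (Ioo r 1) = volume.restrict (Ioo r 1) := by
    rw [hμ, Measure.restrict_restrict measurableSet_Ioo,
      inter_eq_left.2 (Ioo_subset_Ioo_left hr.1.le)]
  have hKint {r : ℝ} (hr : r ∈ Ioo (0 : ℝ) 1) : ∫ w, K w r ∂μ = H r := by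
    rw [integral_congr_ae (hslice hr), integral_indicator measurableSet_Ioo, hset hr,
      ← integral_Ioc_eq_integral_Ioo, ← intervalIntegral.integral_of_le hr.2.le, hH r hr]
  have hKi {r : ℝ} (hr : r ∈ Ioo (0 : ℝ) 1) : Integrable (fun w => K w r) μ := by
    refine (Integrable.congr ?_ (hslice hr).symm)
    rw [integrable_indicator_iff measurableSet_Ioo, IntegrableOn, hset hr]
    exact (intervalIntegrable_iff_integrableOn_Ioo_of_le hr.2.le).1 (hint r hr)
  have hKnn {r : ℝ} (hr : r ∈ Ioo (0 : ℝ) 1) : ∀ᵐ w ∂μ, ‖K w r‖ = K w r := by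
    filter_upwards [ae_restrict_mem measurableSet_Ioo] with w hw
    refine Real.norm_of_nonneg ?_
    by_cases hrw : r < w
    · simpa [hK, hrw] using hnn w hw.2.le r ⟨hr.1, hrw⟩
    · simp [hK, hrw]
  have hHμ : Integrable H μ := (intervalIntegrable_iff_integrableOn_Ioo_of_le zero_le_one).1 hHint
  -- By nonnegativity the norms integrate in `w` to `H`, which is integrable; the bounded factor `y`
  -- is inserted afterwards.
  have hKprod : Integrable (Function.uncurry K) (μ.prod μ) := by
    rw [integrable_prod_iff' hKm.aestronglyMeasurable]
    constructor
    · filter_upwards [ae_restrict_mem measurableSet_Ioo] with r hr using hKi hr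
    · refine hHμ.congr ?_
      filter_upwards [ae_restrict_mem measurableSet_Ioo] with r hr
      rw [← hKint hr]
      exact (integral_congr_ae (hKnn hr)).symm
  have hprod : Integrable (Function.uncurry fun w r => y r * K w r) (μ.prod μ) := by
    refine hKprod.bdd_mul (c := C) (f := fun p => y p.2)
      (hy.comp measurable_snd).aestronglyMeasurable ?_
    have : ∀ᵐ p ∂(μ.prod μ), p ∈ Ioo (0 : ℝ) 1 ×ˢ Ioo (0 : ℝ) 1 := by
      rw [hμ, Measure.prod_restrict]
      exact ae_restrict_mem (measurableSet_Ioo.prod measurableSet_Ioo)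
    filter_upwards [this] with p hp using hC _ hp.2.2.le
  have hswap := integral_integral_swap hprod
  rw [intervalIntegral.integral_of_le zero_le_one, intervalIntegral.integral_of_le zero_le_one,
    integral_Ioc_eq_integral_Ioo, integral_Ioc_eq_integral_Ioo]
  refine Eq.trans ?_ (hswap.trans ?_)
  · refine setIntegral_congr_fun measurableSet_Ioo fun w hw => ?_
    have : (fun r => y r * K w r) =ᵐ[μ] (Ioo 0 w).indicator fun r => y r * h w r := by
      filter_upwards [ae_restrict_mem measurableSet_Ioo] with r hr
      by_cases hrw : r < w
      · simp [hK, hrw, hr.1]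
      · simp [hK, hrw]
    rw [integral_congr_ae this, integral_indicator measurableSet_Ioo, hμ,
      Measure.restrict_restrict measurableSet_Ioo,
      inter_eq_left.2 (Ioo_subset_Ioo_right hw.2.le), intervalIntegral.integral_of_le hw.1.le,
      integral_Ioc_eq_integral_Ioo]
  · refine setIntegral_congr_fun measurableSet_Ioo fun r hr => ?_
    rw [integral_const_mul, hKint hr]

lemma toNNReal_coe_mul (t : ℝ≥0) (v : ℝ) : ((t : ℝ) * v).toNNReal = t * v.toNNReal := by
  rw [Real.toNNReal_mul t.coe_nonneg, Real.toNNReal_coe]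

lemma integral_zero_to_eq_mul (t : ℝ≥0) (F : ℝ → ℝ) :
    ∫ s in (0 : ℝ)..t, F s = t * ∫ v in (0 : ℝ)..1, F (t * v) := by
  rw [intervalIntegral.mul_integral_comp_mul_left, mul_zero, mul_one]

section Path

variable {Ω : Type u} {X : ℝ≥0 → Ω → ℝ} {ω : Ω}

lemma runningIntegral_eq (X : ℝ≥0 → Ω → ℝ) (t : ℝ≥0) (ω : Ω) :
    runningIntegral X t ω = t * ∫ v in (0 : ℝ)..1, X (t * v.toNNReal) ω := by
  rw [runningIntegral, integral_zero_to_eq_mul]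
  simp only [toNNReal_coe_mul]

lemma runningAverage_eq {t : ℝ≥0} (h0 : X 0 ω = 0) :
    runningAverage X t ω = ∫ v in (0 : ℝ)..1, X (t * v.toNNReal) ω := by
  rw [runningAverage, runningIntegral_eq]
  -- At `t = 0` the left side is `0⁻¹ * (0 * _) = 0`, and the right side vanishes because the path
  -- starts at `0`.
  rcases eq_or_ne t 0 with rfl | ht
  · simp [h0]
  · rw [inv_mul_cancel_left₀ (by exact_mod_cast ht)]

/-- The substitution `r = wv` brings the inner integral of an iterated average to the triangle `r <
w`. -/
lemma integral_comp_mul_kernel {x : ℝ≥0 → ℝ} (t : ℝ≥0) {w : ℝ} (hw : 0 < w) (k : ℝ → ℝ) :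
    ∫ v in (0 : ℝ)..1, x (t * w.toNNReal * v.toNNReal) * k v =
      ∫ r in (0 : ℝ)..w, x (t * r.toNNReal) * (k (r / w) / w) := by
  have h := integral_zero_to_eq_mul w.toNNReal fun r => x (t * r.toNNReal) * (k (r / w) / w)
  rw [Real.coe_toNNReal w hw.le] at h
  rw [h, ← intervalIntegral.integral_const_mul]
  refine intervalIntegral.integral_congr fun v _ => ?_
  simp only [Real.toNNReal_mul hw.le, mul_div_cancel_left₀ v hw.ne', ← mul_assoc t]
  field_simp

lemma intervalIntegrable_neg_log_pow (m : ℕ) :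
    IntervalIntegrable (fun v => (-Real.log v) ^ m) volume 0 1 := by
  simpa using intervalIntegrable_neg_log_rpow (n := m + 1) (by positivity)

/-- Induction with the two integrations exchanged: the weight of the next degree is `∫_r^1 (log w -
log r)^m / m! dw/w = (-log r)^(m+1)/(m+1)!`. -/
lemma IsSubordinatorPath.runningAverage_iterate (hx : IsSubordinatorPath fun t => X t ω) (m : ℕ)
    (t : ℝ≥0) : (runningAverage^[m + 1] X) t ω =
      ∫ v in (0 : ℝ)..1, X (t * v.toNNReal) ω * ((-Real.log v) ^ m / (m ! : ℝ)) := by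
  induction m generalizing t with
  | zero => simp [runningAverage_eq hx.zero]
  | succ m ih =>
    have hx0 : X 0 ω = 0 := hx.zero
    rw [Function.iterate_succ_apply', runningAverage_eq (by rw [ih]; simp [hx0])]
    have hderiv (r w : ℝ) (hw : w ≠ 0) : HasDerivAt
        (fun w => (Real.log w - Real.log r) ^ (m + 1) / ((m + 1)! : ℝ))
        ((Real.log w - Real.log r) ^ m / (m ! : ℝ) / w) w := by
      convert! (((Real.hasDerivAt_log hw).sub_const (Real.log r)).pow (m + 1)).div_const
        ((m + 1)! : ℝ) using 1
      rw [Nat.factorial_succ]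
      push_cast
      field_simp
    have hcont {r : ℝ} (hr : r ∈ Ioo (0 : ℝ) 1) : IntervalIntegrable
        (fun w => (Real.log w - Real.log r) ^ m / (m ! : ℝ) / w) volume r 1 := by
      refine ContinuousOn.intervalIntegrable fun w hw => ContinuousAt.continuousWithinAt ?_
      rw [uIcc_of_le hr.2.le] at hw
      have : w ≠ 0 := (hr.1.trans_le hw.1).ne'
      fun_prop (disch := assumption)
    rw [← integral_triangle_swap (h := fun w r => (Real.log w - Real.log r) ^ m / (m ! : ℝ) / w)
      (by simp only [Function.uncurry_def]; fun_prop) ?_ (fun r hr => hcont hr) ?_ ?_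
      (hx.monotone_toNNReal t).measurable (fun v hv => hx.norm_le t hv)]
    · refine intervalIntegral.integral_congr_ae (.of_forall fun w hw => ?_)
      rw [uIoc_of_le zero_le_one] at hw
      rw [ih, integral_comp_mul_kernel (x := fun t => X t ω) t hw.1
        fun v => (-Real.log v) ^ m / (m ! : ℝ)]
      refine intervalIntegral.integral_congr_ae (.of_forall fun r hr => ?_)
      rw [uIoc_of_le hw.1.le] at hr
      rw [Real.log_div hr.1.ne' hw.1.ne', neg_sub]
    · intro w _ r hr
      have := Real.log_le_log hr.1 hr.2.le
      have := hr.1.trans hr.2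
      have : 0 ≤ Real.log w - Real.log r := by linarith
      positivity
    · intro r hr
      rw [intervalIntegral.integral_eq_sub_of_hasDerivAt (fun w hw => hderiv r w ?_) (hcont hr)]
      · simp
      · rw [uIcc_of_le hr.2.le] at hw
        exact (hr.1.trans_le hw.1).ne'
    · exact (intervalIntegrable_neg_log_pow (m + 1)).div_const _

/-- Cauchy's formula for repeated integration, rescaled to the unit interval; the induction step
rests on `∫_r^1 (w-r)^m / m! dw = (1-r)^(m+1)/(m+1)!`. -/
lemma IsSubordinatorPath.runningIntegral_iterate (hx : IsSubordinatorPath fun t => X t ω) (m : ℕ)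
    (t : ℝ≥0) : (runningIntegral^[m + 1] X) t ω = (t : ℝ) ^ (m + 1) *
      ∫ v in (0 : ℝ)..1, X (t * v.toNNReal) ω * ((1 - v) ^ m / (m ! : ℝ)) := by
  induction m generalizing t with
  | zero => simp [runningIntegral_eq]
  | succ m ih =>
    rw [Function.iterate_succ_apply', runningIntegral_eq]
    have hderiv (r w : ℝ) : HasDerivAt (fun w => (w - r) ^ (m + 1) / ((m + 1)! : ℝ))
        ((w - r) ^ m / (m ! : ℝ)) w := by
      convert! (((hasDerivAt_id w).sub_const r).pow (m + 1)).div_const ((m + 1)! : ℝ) using 1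
      rw [Nat.factorial_succ]
      push_cast
      simp only [id]
      field_simp
    have hcont (r : ℝ) : IntervalIntegrable (fun w => (w - r) ^ m / (m ! : ℝ)) volume r 1 :=
      Continuous.intervalIntegrable (by fun_prop) _ _
    rw [← integral_triangle_swap (h := fun w r => (w - r) ^ m / (m ! : ℝ))
      (by simp only [Function.uncurry_def]; fun_prop) ?_ (fun r _ => hcont r) ?_ ?_
      (hx.monotone_toNNReal t).measurable (fun v hv => hx.norm_le t hv)]
    · rw [pow_succ' (t : ℝ) (m + 1), mul_assoc]
      congr 1
      rw [← intervalIntegral.integral_const_mul]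
      refine intervalIntegral.integral_congr_ae (.of_forall fun w hw => ?_)
      rw [uIoc_of_le zero_le_one] at hw
      rw [ih, integral_comp_mul_kernel (x := fun t => X t ω) t hw.1
        fun v => (1 - v) ^ m / (m ! : ℝ), NNReal.coe_mul, Real.coe_toNNReal _ hw.1.le, mul_pow,
        mul_assoc, ← intervalIntegral.integral_const_mul]
      congr 1
      refine intervalIntegral.integral_congr fun r _ => ?_
      have : w - r = w * (1 - r / w) := by field_simp [hw.1.ne']
      rw [this, mul_pow]
      have := hw.1.ne'
      field_simp
      ring
    · intro w _ r hr
      have : 0 ≤ w - r := by linarith [hr.2]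
      positivity
    · intro r hr
      rw [intervalIntegral.integral_eq_sub_of_hasDerivAt (fun w _ => hderiv r w) (hcont r)]
      simp
    · exact Continuous.intervalIntegrable (by fun_prop) _ _

/-- Both descriptions of the type I average are integrals with the same logarithmic weight. -/
lemma IsTypeIAverage.eq_integral {n : ℝ} {A : ℝ≥0 → Ω → ℝ} (hA : IsTypeIAverage X n A)
    (hx : IsSubordinatorPath fun t => X t ω) (t : ℝ≥0) :
    A t ω = ∫ v in (0 : ℝ)..1,
      X (t * v.toNNReal) ω * ((-Real.log v) ^ (n - 1) / Real.Gamma n) := by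
  rcases hA with ⟨k, hk⟩ | ⟨n, hn⟩
  · obtain ⟨m, rfl⟩ := Nat.exists_eq_add_of_le' hk
    rw [hx.runningAverage_iterate]
    push_cast
    simp only [add_sub_cancel_right, Real.rpow_natCast, Real.Gamma_nat_eq_factorial]
  · have hx0 : X 0 ω = 0 := hx.zero
    rcases eq_or_ne t 0 with rfl | ht
    · simp [hx0]
    have ht' : (t : ℝ) ≠ 0 := by exact_mod_cast ht
    beta_reduce
    rw [integral_zero_to_eq_mul, ← mul_assoc, ← intervalIntegral.integral_const_mul]
    refine intervalIntegral.integral_congr fun v _ => ?_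
    rw [toNNReal_coe_mul, div_mul_cancel_left₀ ht', Real.log_inv]
    field_simp

/-- Both descriptions of the type III average are integrals with the same weight. -/
lemma IsTypeIIIAverage.eq_integral {n : ℝ} {A : ℝ≥0 → Ω → ℝ} (hA : IsTypeIIIAverage X n A)
    (hx : IsSubordinatorPath fun t => X t ω) (t : ℝ≥0) :
    A t ω = ∫ v in (0 : ℝ)..1, X (t * v.toNNReal) ω * ((1 - v) ^ (n - 1) / Real.Gamma n) := by
  have hx0 : X 0 ω = 0 := hx.zero
  rcases hA with ⟨k, hk⟩ | ⟨n, hn⟩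
  · obtain ⟨m, rfl⟩ := Nat.exists_eq_add_of_le' hk
    simp only
    rw [hx.runningIntegral_iterate]
    push_cast
    simp only [add_sub_cancel_right, Real.rpow_natCast, Real.Gamma_nat_eq_factorial]
    rcases eq_or_ne t 0 with rfl | ht
    · simp [hx0]
    rw [one_div, inv_mul_cancel_left₀]
    have ht' : (t : ℝ) ≠ 0 := by exact_mod_cast ht
    positivity
  · rcases eq_or_ne t 0 with rfl | ht
    · simp [hx0]
    have ht' : (0 : ℝ) < t := by exact_mod_cast pos_iff_ne_zero.2 ht
    simp only
    rw [integral_zero_to_eq_mul, ← mul_assoc, ← intervalIntegral.integral_const_mul]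
    refine intervalIntegral.integral_congr_ae (.of_forall fun v hv => ?_)
    rw [uIoc_of_le zero_le_one] at hv
    rw [toNNReal_coe_mul, show (t : ℝ) - t * v = t * (1 - v) by ring,
      Real.mul_rpow ht'.le (by linarith [hv.2]), Real.rpow_sub_one ht'.ne']
    have : (t : ℝ) ^ n ≠ 0 := (Real.rpow_pos_of_pos ht' n).ne'
    field_simp

end Path

/-! ### Weighted integrals of a Poisson process -/

section Laws

variable {Ω : Type u} [MeasurableSpace Ω] {P : Measure Ω} {lam : ℝ≥0} {X : ℝ≥0 → Ω → ℝ}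

lemma IsPoissonProcess.ae_nonneg (hX : IsPoissonProcess X lam P) (t : ℝ≥0) :
    ∀ᵐ ω ∂P, 0 ≤ X t ω := by
  refine ae_of_ae_map (hX.levy.measurable t).aemeasurable (p := fun x => 0 ≤ x) ?_
  rw [hX.law t]
  exact (ae_map_iff (by fun_prop) measurableSet_Ici).2 (.of_forall fun k => Nat.cast_nonneg k)

lemma IsPoissonProcess.charFun_eq (hX : IsPoissonProcess X lam P) (t : ℝ≥0) (ξ : ℝ) :
    charFun (P.map (X t)) ξ = Complex.exp (t * (lam * (Complex.exp (ξ * Complex.I) - 1))) := by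
  rw [hX.law t, charFun_map_cast_poissonMeasure]
  push_cast
  ring_nf

end Laws

/-! ### The tail `G` of a weight `g`, and the image of the uniform law under it. -/

section Weight

variable {g G : ℝ → ℝ}

lemma continuousOn_tail (hg : IntervalIntegrable g volume 0 1)
    (hG : ∀ v ∈ Icc (0 : ℝ) 1, ∫ w in v..1, g w = G v) : ContinuousOn G (Icc 0 1) := by
  have := intervalIntegral.continuousOn_primitive_interval_left
    (f := g) (μ := volume) (a := 0) (b := 1)
    (by rwa [uIcc_of_le zero_le_one, integrableOn_Icc_iff_integrableOn_Ioc,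
      ← intervalIntegrable_iff_integrableOn_Ioc_of_le zero_le_one])
  rw [uIcc_of_le zero_le_one] at this
  exact this.congr fun v hv => (hG v hv).symm

lemma strictAntiOn_tail (hg : IntervalIntegrable g volume 0 1) (hpos : ∀ v ∈ Ioo (0 : ℝ) 1, 0 < g v)
    (hG : ∀ v ∈ Icc (0 : ℝ) 1, ∫ w in v..1, g w = G v) : StrictAntiOn G (Icc 0 1) := by
  intro a ha b hb hab
  have hsub {c d : ℝ} (hc : c ∈ Icc (0 : ℝ) 1) (hd : d ∈ Icc (0 : ℝ) 1) :
      IntervalIntegrable g volume c d := hg.mono_set (by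
    rw [uIcc_of_le zero_le_one]; exact uIcc_subset_Icc hc hd)
  rw [← hG a ha, ← hG b hb, ← intervalIntegral.integral_add_adjacent_intervals (hsub ha hb)
    (hsub hb ⟨zero_le_one, le_rfl⟩), lt_add_iff_pos_left]
  exact intervalIntegral.intervalIntegral_pos_of_pos_on (hsub ha hb)
    (fun x hx => hpos x ⟨ha.1.trans_lt hx.1, hx.2.trans_le hb.2⟩) hab

lemma image_tail_Ioo (hg : IntervalIntegrable g volume 0 1) (hpos : ∀ v ∈ Ioo (0 : ℝ) 1, 0 < g v)
    (hG : ∀ v ∈ Icc (0 : ℝ) 1, ∫ w in v..1, g w = G v) : G '' Ioo 0 1 = Ioo 0 (G 0) := by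
  have hanti := strictAntiOn_tail hg hpos hG
  have h1 : G 1 = 0 := by rw [← hG 1 (by simp), intervalIntegral.integral_same]
  refine Subset.antisymm ?_ ?_
  · rintro _ ⟨v, hv, rfl⟩
    have hv' := Ioo_subset_Icc_self hv
    exact ⟨h1 ▸ hanti hv' (by simp) hv.2, hanti (by simp) hv' hv.1⟩
  · have := intermediate_value_Ioo' zero_le_one (continuousOn_tail hg hG)
    rwa [h1] at this

lemma hasDerivWithinAt_tail (hg : IntervalIntegrable g volume 0 1)
    (hgc : ContinuousOn g (Ioo 0 1))
    (hG : ∀ v ∈ Icc (0 : ℝ) 1, ∫ w in v..1, g w = G v) {v : ℝ} (hv : v ∈ Ioo (0 : ℝ) 1) :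
    HasDerivWithinAt G (-g v) (Ioo 0 1) v := by
  have h := intervalIntegral.integral_hasDerivAt_left (hg.mono_set (by
      rw [uIcc_of_le zero_le_one]
      exact uIcc_subset_Icc (Ioo_subset_Icc_self hv) ⟨zero_le_one, le_rfl⟩))
    (hgc.stronglyMeasurableAtFilter isOpen_Ioo v hv) (hgc.continuousAt (isOpen_Ioo.mem_nhds hv))
  exact h.hasDerivWithinAt.congr (fun w hw => (hG w (Ioo_subset_Icc_self hw)).symm)
    (hG v (Ioo_subset_Icc_self hv)).symm

lemma aemeasurable_tail (hg : IntervalIntegrable g volume 0 1)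
    (hG : ∀ v ∈ Icc (0 : ℝ) 1, ∫ w in v..1, g w = G v) :
    AEMeasurable G (volume.restrict (Ioo 0 1)) :=
  ((continuousOn_tail hg hG).mono Ioo_subset_Icc_self).aemeasurable measurableSet_Ioo

/-- The density of the image of the uniform law under a decreasing function `G`. -/
lemma densityMeasure_eq_map_tail (hg : IntervalIntegrable g volume 0 1)
    (hpos : ∀ v ∈ Ioo (0 : ℝ) 1, 0 < g v) (hgc : ContinuousOn g (Ioo 0 1))
    (hG : ∀ v ∈ Icc (0 : ℝ) 1, ∫ w in v..1, g w = G v) {ρ : ℝ → ℝ}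
    (hρ : ∀ v ∈ Ioo (0 : ℝ) 1, ρ (G v) * g v = 1) (hsupp : ∀ z ∉ Ioc 0 (G 0), ρ z = 0) :
    densityMeasure ρ = (volume.restrict (Ioo 0 1)).map G := by
  ext B hB
  have hGm := aemeasurable_tail hg hG
  rw [densityMeasure, withDensity_apply _ hB, ← lintegral_indicator_one hB,
    lintegral_map' (by fun_prop (disch := exact hB)) hGm, ← lintegral_indicator hB]
  -- Dropping the null point `G 0` leaves exactly the image of `Ioo 0 1` under `G`, on which the
  -- change of variables takes place.
  have hae : (B.indicator fun z => ENNReal.ofReal (ρ z)) =ᵐ[volume]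
      (Ioo 0 (G 0)).indicator (B.indicator fun z => ENNReal.ofReal (ρ z)) := by
    filter_upwards [compl_mem_ae_iff.2 (measure_singleton (G 0))] with z hz
    by_cases h : z ∈ Ioo 0 (G 0)
    · rw [indicator_of_mem h]
    · rw [indicator_of_notMem h]
      have : ρ z = 0 := hsupp z fun hz' => h ⟨hz'.1, lt_of_le_of_ne hz'.2 hz⟩
      simp [this]
  rw [lintegral_congr_ae hae, lintegral_indicator measurableSet_Ioo, ← image_tail_Ioo hg hpos hG,
    lintegral_image_eq_lintegral_abs_deriv_mul measurableSet_Ioo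
      (fun v hv => hasDerivWithinAt_tail hg hgc hG hv)
      ((strictAntiOn_tail hg hpos hG).injOn.mono Ioo_subset_Icc_self)]
  refine setLIntegral_congr_fun measurableSet_Ioo fun v hv => ?_
  by_cases h : G v ∈ B
  · simp only [indicator_of_mem h, Pi.one_apply]
    rw [← ENNReal.ofReal_mul (abs_nonneg _), abs_neg, abs_of_pos (hpos v hv), mul_comm, hρ v hv,
      ENNReal.ofReal_one]
  · simp [h]

/-- A process given by weighted integrals `∫_0^1 X_{tv} g(v) dv` of a Poisson process. -/
theorem IsPoissonProcess.laplace_and_hasBoundedJumpDensity {Ω : Type u} [MeasurableSpace Ω]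
    {P : Measure Ω} {lam : ℝ≥0} (hlam : 0 < lam) {X : ℝ≥0 → Ω → ℝ} (hX : IsPoissonProcess X lam P)
    (hg : IntervalIntegrable g volume 0 1)
    (hpos : ∀ v ∈ Ioo (0 : ℝ) 1, 0 < g v) (hgc : ContinuousOn g (Ioo 0 1))
    (hG : ∀ v ∈ Icc (0 : ℝ) 1, ∫ w in v..1, g w = G v) {ℓ : ℝ → ℝ}
    (hℓ : ∀ v ∈ Ioo (0 : ℝ) 1, ℓ (G v) * g v = lam) (hsupp : ∀ z ∉ Ioc 0 (G 0), ℓ z = 0)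
    {A : ℝ≥0 → Ω → ℝ} (hA : ∀ (ω : Ω) (t : ℝ≥0), IsSubordinatorPath (fun t => X t ω) →
      A t ω = ∫ v in (0 : ℝ)..1, X (t * v.toNNReal) ω * g v) :
    (∀ u : ℂ, laplace (A 1) P u =
      Complex.exp (lam * ((∫ v in (0 : ℝ)..1, Complex.exp (-u * G v)) - 1))) ∧
    HasBoundedJumpDensity.{u, v} A P lam ℓ (G 0) := by
  have hP := hX.levy.isProbabilityMeasure
  have hlam' : (lam : ℝ) ≠ 0 := by exact_mod_cast hlam.ne'
  have hmain (t : ℝ≥0) := hX.levy.charFun_weighted_integral hX.ae_nonneg (by fun_prop)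
    hX.charFun_eq hg t
  have hAeq (t : ℝ≥0) :
      (fun ω => ∫ v in (0 : ℝ)..1, X (t * v.toNNReal) ω * g v) =ᵐ[P] A t := by
    filter_upwards [hX.levy.ae_isSubordinatorPath hX.ae_nonneg] with ω hω using (hA ω t hω).symm
  have hGm := aemeasurable_tail hg hG
  -- The normalized density is the law of `G(U)` with `U` uniform, so integrals against the jump law
  -- are integrals over `v` in the unit interval.
  have hmap := densityMeasure_eq_map_tail hg hpos hgc hG (ρ := fun z => ℓ z / lam)
    (fun v hv => by rw [div_mul_eq_mul_div, hℓ v hv, div_self hlam'])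
    (fun z hz => by rw [hsupp z hz, zero_div])
  have hexp (w : ℂ) : ∫ z : ℝ, Complex.exp (w * z) ∂(densityMeasure fun z => ℓ z / lam) =
      ∫ v in (0 : ℝ)..1, Complex.exp (w * G v) := by
    rw [hmap, integral_map hGm (by fun_prop), intervalIntegral.integral_of_le zero_le_one,
      integral_Ioc_eq_integral_Ioo]
  have hprob : IsProbabilityMeasure (densityMeasure fun z => ℓ z / lam) := by
    have : IsProbabilityMeasure (volume.restrict (Ioo (0 : ℝ) 1)) := ⟨by simp⟩
    rw [hmap]
    exact Measure.isProbabilityMeasure_map hGm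
  have hconc : densityMeasure (fun z => ℓ z / lam) (Ioc 0 (G 0))ᶜ = 0 := by
    rw [densityMeasure, withDensity_apply _ measurableSet_Ioc.compl,
      setLIntegral_congr_fun (g := fun _ => 0) measurableSet_Ioc.compl fun z hz => by
        simp [hsupp z hz]]
    simp
  have hfin := laplace_and_hasBoundedJumpDensity_of_charFun.{u, v} (A := A) (P := P) hlam
    (fun t => (hmain t).1.congr (hAeq t)) hprob hconc fun t ξ => by
      rw [← Measure.map_congr (hAeq t), (hmain t).2, charFun_apply_real,
        intervalIntegral.integral_congr (g := fun v => lam *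
          (Complex.exp (ξ * Complex.I * G v) - 1)) fun v hv => ?_,
        intervalIntegral.integral_const_mul, intervalIntegral.integral_sub, ← hexp]
      · simp only [intervalIntegral.integral_const, sub_zero, one_smul]
        simp only [mul_right_comm (ξ : ℂ) Complex.I]
        congr 1
        ring
      · refine ContinuousOn.intervalIntegrable ?_
        have := continuousOn_tail hg hG
        rw [uIcc_of_le zero_le_one]
        fun_prop
      · simp
      · rw [uIcc_of_le zero_le_one] at hv
        simp only [hG v hv]
        push_cast
        ring_nf
  simp only [hexp] at hfin
  exact hfin

end Weight

/-! ### The incomplete gamma function of a complex argument -/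

/-- The integral `∫_0^1 r^(a-1) e^(-wr) dr`, which is `w^(-a) γ(a, w)`, `γ` being the lower
incomplete gamma function. -/
def entireLowerGamma (a : ℝ) (w : ℂ) : ℂ :=
  ∫ r in (0 : ℝ)..1, ((r ^ (a - 1) : ℝ) : ℂ) * Complex.exp (-(w * r))

lemma intervalIntegrable_rpow_mul {a : ℝ} (ha : 0 < a) {f : ℝ → ℂ} (hf : Continuous f) (b c : ℝ) :
    IntervalIntegrable (fun r : ℝ => ((r ^ (a - 1) : ℝ) : ℂ) * f r) volume b c := by
  have h : IntervalIntegrable (fun r : ℝ => r ^ (a - 1)) volume b c :=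
    intervalIntegral.intervalIntegrable_rpow' (by linarith)
  have h' : IntervalIntegrable (fun r : ℝ => ((r ^ (a - 1) : ℝ) : ℂ)) volume b c :=
    ⟨h.1.ofReal, h.2.ofReal⟩
  exact h'.mul_continuousOn hf.continuousOn

/-- Differentiation under the integral brings down a factor `-r`, which raises `a` by one. On the
unit ball around `w` the exponential is at most `e^(‖w‖+1)`. -/
lemma hasDerivAt_entireLowerGamma {a : ℝ} (ha : 0 < a) (w : ℂ) :
    HasDerivAt (entireLowerGamma a) (-entireLowerGamma (a + 1) w) w := by
  have h := (intervalIntegral.hasDerivAt_integral_of_dominated_loc_of_deriv_le (μ := volume)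
    (a := 0) (b := 1) (F := fun w r => ((r ^ (a - 1) : ℝ) : ℂ) * Complex.exp (-(w * r)))
    (F' := fun w r => ((r ^ (a - 1) : ℝ) : ℂ) * (Complex.exp (-(w * r)) * -(1 * r)))
    (x₀ := w) (s := Metric.ball w 1) (bound := fun r => r ^ (a - 1) * Real.exp (‖w‖ + 1))
    (Metric.ball_mem_nhds w one_pos) (.of_forall fun z => by fun_prop)
    (intervalIntegrable_rpow_mul ha (by fun_prop) _ _) (by fun_prop) ?_ ?_ ?_).2
  · convert! h using 1
    rw [entireLowerGamma, ← intervalIntegral.integral_neg]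
    refine intervalIntegral.integral_congr_ae (.of_forall fun r hr => ?_)
    rw [uIoc_of_le zero_le_one] at hr
    rw [add_sub_cancel_right, Real.rpow_sub_one hr.1.ne']
    have : (r : ℂ) ≠ 0 := by exact_mod_cast hr.1.ne'
    push_cast
    field_simp
  · refine .of_forall fun r hr z hz => ?_
    rw [uIoc_of_le zero_le_one] at hr
    have hz' : ‖z‖ ≤ ‖w‖ + 1 := by
      have := norm_le_norm_add_norm_sub' z w
      rw [← dist_eq_norm] at this
      linarith [Metric.mem_ball.1 hz]
    have hexp : ‖Complex.exp (-(z * r))‖ ≤ Real.exp (‖w‖ + 1) := by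
      refine (Complex.norm_exp_le_exp_norm _).trans (Real.exp_le_exp.2 ?_)
      rw [norm_neg, norm_mul, Complex.norm_real, Real.norm_of_nonneg hr.1.le]
      nlinarith [norm_nonneg z, hr.2]
    rw [norm_mul, norm_mul, one_mul, norm_neg, Complex.norm_real, Complex.norm_real,
      Real.norm_of_nonneg (Real.rpow_nonneg hr.1.le _), Real.norm_of_nonneg hr.1.le]
    refine mul_le_mul_of_nonneg_left ?_ (Real.rpow_nonneg hr.1.le _)
    exact (mul_le_of_le_one_right (norm_nonneg _) hr.2).trans hexp
  · exact (intervalIntegral.intervalIntegrable_rpow' (by linarith)).mul_const _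
  · refine .of_forall fun r _ z _ => ?_
    exact (((hasDerivAt_id z).mul_const (r : ℂ)).neg.cexp).const_mul _

/-- Obtained by integrating the derivative of `r^a e^{-wr}` over `[0,1]`. At `r = 0` only continuity
is used, as the derivative may blow up there when `a < 1`. -/
lemma entireLowerGamma_add_one {a : ℝ} (ha : 0 < a) (w : ℂ) :
    w * entireLowerGamma (a + 1) w = a * entireLowerGamma a w - Complex.exp (-w) := by
  have hd (r : ℝ) (hr : r ∈ Ioo (0 : ℝ) 1) : HasDerivAt
      (fun r : ℝ => ((r ^ a : ℝ) : ℂ) * Complex.exp (-(w * r)))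
      (a * (((r ^ (a - 1) : ℝ) : ℂ) * Complex.exp (-(w * r))) -
        w * (((r ^ (a + 1 - 1) : ℝ) : ℂ) * Complex.exp (-(w * r)))) r := by
    have h1 := (Real.hasDerivAt_rpow_const (p := a) (Or.inl hr.1.ne')).ofReal_comp
    have h2 : HasDerivAt (fun r : ℝ => Complex.exp (-(w * r)))
        (Complex.exp (-(w * r)) * -(w * 1)) r :=
      ((hasDerivAt_id (r : ℂ)).const_mul w).neg.cexp.comp_ofReal
    convert! h1.mul h2 using 1
    rw [add_sub_cancel_right]
    push_cast
    ring
  have hi1 := (intervalIntegrable_rpow_mul ha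
    (f := fun r : ℝ => Complex.exp (-(w * r))) (by fun_prop) 0 1).const_mul (a : ℂ)
  have hi2 := (intervalIntegrable_rpow_mul (a := a + 1) (by linarith)
    (f := fun r : ℝ => Complex.exp (-(w * r))) (by fun_prop) 0 1).const_mul w
  have hc : ContinuousOn (fun r : ℝ => ((r ^ a : ℝ) : ℂ) * Complex.exp (-(w * r))) (Icc 0 1) := by
    have : Continuous fun r : ℝ => r ^ a := Real.continuous_rpow_const ha.le
    fun_prop
  have h := intervalIntegral.integral_eq_sub_of_hasDerivAt_of_le zero_le_one hc hd (hi1.sub hi2)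
  rw [intervalIntegral.integral_sub hi1 hi2, intervalIntegral.integral_const_mul,
    intervalIntegral.integral_const_mul, Real.zero_rpow ha.ne', Real.one_rpow] at h
  simp only [Complex.ofReal_one, one_mul, mul_one, Complex.ofReal_zero, zero_mul, sub_zero] at h
  rw [entireLowerGamma, entireLowerGamma, ← h]
  ring

/-- Provides an antiderivative of the incomplete gamma integrand on the slit plane. -/
lemma hasDerivAt_cpow_mul_entireLowerGamma {a : ℝ} (ha : 0 < a) {w : ℂ}
    (hw : w ∈ Complex.slitPlane) :
    HasDerivAt (fun w : ℂ => w ^ (a : ℂ) * entireLowerGamma a w)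
      (w ^ ((a : ℂ) - 1) * Complex.exp (-w)) w := by
  convert! ((hasDerivAt_id w).cpow_const (c := (a : ℂ)) hw).mul
    (hasDerivAt_entireLowerGamma ha w) using 1
  have h0 := Complex.slitPlane_ne_zero hw
  have hpow : w ^ (a : ℂ) = w ^ ((a : ℂ) - 1) * w := by
    rw [Complex.cpow_sub _ _ h0, Complex.cpow_one, div_mul_cancel₀ _ h0]
  have := entireLowerGamma_add_one ha w
  simp only [id]
  rw [hpow]
  linear_combination w ^ ((a : ℂ) - 1) * this

lemma ofReal_mul_cpow {r : ℝ} (hr : 0 < r) {z : ℂ} (hz : z ≠ 0) (a : ℂ) :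
    ((r : ℂ) * z) ^ a = (r : ℂ) ^ a * z ^ a := by
  have hr' : (r : ℂ) ≠ 0 := by exact_mod_cast hr.ne'
  rw [Complex.cpow_def_of_ne_zero (mul_ne_zero hr' hz), Complex.cpow_def_of_ne_zero hr',
    Complex.cpow_def_of_ne_zero hz, Complex.log_ofReal_mul hr hz, add_mul, Complex.exp_add,
    Complex.ofReal_log hr.le]

lemma cpow_mul_entireLowerGamma_scale (a : ℝ) {T : ℝ} (hT : 0 < T) (ζ : ℂ) :
    (T : ℂ) ^ (a : ℂ) * entireLowerGamma a (T * ζ) =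
      ∫ s in (0 : ℝ)..T, ((s ^ (a - 1) : ℝ) : ℂ) * Complex.exp (-(ζ * s)) := by
  have h := intervalIntegral.smul_integral_comp_mul_left (a := 0) (b := 1) 
    (fun s : ℝ => ((s ^ (a - 1) : ℝ) : ℂ) * Complex.exp (-(ζ * s))) T
  rw [mul_zero, mul_one] at h
  rw [← h, entireLowerGamma, Complex.real_smul, ← intervalIntegral.integral_const_mul,
    ← intervalIntegral.integral_const_mul]
  refine intervalIntegral.integral_congr_ae (.of_forall fun r hr => ?_)
  rw [uIoc_of_le zero_le_one] at hr
  rw [Real.mul_rpow hT.le hr.1.le, ← Complex.ofReal_cpow hT.le, Real.rpow_sub_one hT.ne']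
  have : (T : ℂ) ≠ 0 := by exact_mod_cast hT.ne'
  push_cast
  field_simp

lemma integrableOn_rpow_mul_exp_neg {a b : ℝ} (ha : 0 < a) (hb : 0 < b) :
    IntegrableOn (fun s : ℝ => s ^ (a - 1) * Real.exp (-b * s)) (Ioi 0) := by
  simpa using integrableOn_rpow_mul_exp_neg_mul_rpow (p := 1) (s := a - 1) (by linarith) one_pos hb

lemma setIntegral_rpow_mul_cexp_neg {a : ℝ} (ha : 0 < a) :
    ∫ s in Ioi (0 : ℝ), ((s ^ (a - 1) : ℝ) : ℂ) * Complex.exp (-s) = Real.Gamma a := by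
  rw [Real.Gamma_eq_integral ha, ← integral_complex_ofReal]
  refine integral_congr_ae (.of_forall fun s => ?_)
  push_cast
  ring

lemma tendsto_one_add_div (w : ℂ) : Tendsto (fun T : ℝ => 1 + w / T) atTop (𝓝 1) := by
  have h : Tendsto (fun T : ℝ => ((T⁻¹ : ℝ) : ℂ)) atTop (𝓝 ((0 : ℝ) : ℂ)) :=
    (Complex.continuous_ofReal.tendsto 0).comp tendsto_inv_atTop_zero
  simpa [div_eq_mul_inv] using (h.const_mul w).const_add 1

/-- Writing `w + T = T(1 + w/T)` and rescaling leaves `∫_0^T s^(a-1) e^{-(1+w/T)s} ds` times a power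
tending to `1`. The integrand is dominated by `s^(a-1) e^{-s/2}` as soon as `Re(1 + w/T) > 1/2`. -/
lemma tendsto_cpow_mul_entireLowerGamma {a : ℝ} (ha : 0 < a) (w : ℂ) :
    Tendsto (fun T : ℝ => (w + T) ^ (a : ℂ) * entireLowerGamma a (w + T)) atTop
      (𝓝 (Real.Gamma a : ℂ)) := by
  have hζ := tendsto_one_add_div w
  have hint : Tendsto (fun T : ℝ => ∫ s in Ioi (0 : ℝ), (Iic T).indicator
      (fun s => ((s ^ (a - 1) : ℝ) : ℂ) * Complex.exp (-((1 + w / T) * s))) s) atTop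
      (𝓝 (Real.Gamma a : ℂ)) := by
    rw [← setIntegral_rpow_mul_cexp_neg ha]
    refine tendsto_integral_filter_of_dominated_convergence
      (fun s => s ^ (a - 1) * Real.exp (-(1 / 2) * s)) (.of_forall fun T => ?_) ?_
      (integrableOn_rpow_mul_exp_neg ha (by norm_num)) ?_
    · exact (AEStronglyMeasurable.indicator (by fun_prop) measurableSet_Iic)
    · have hre : ∀ᶠ T : ℝ in atTop, 1 / 2 < (1 + w / T : ℂ).re :=
        ((Complex.continuous_re.tendsto _).comp hζ).eventually_const_lt (by norm_num)
      filter_upwards [hre] with T hT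
      filter_upwards [ae_restrict_mem measurableSet_Ioi] with s hs
      have hs' : (0 : ℝ) < s := hs
      refine (norm_indicator_le_norm_self _ _).trans ?_
      rw [norm_mul, Complex.norm_real, Real.norm_of_nonneg (Real.rpow_nonneg hs'.le _),
        Complex.norm_exp, Complex.neg_re, Complex.re_mul_ofReal]
      gcongr
      nlinarith
    · filter_upwards [ae_restrict_mem measurableSet_Ioi] with s hs
      have hlim : Tendsto (fun T : ℝ => ((s ^ (a - 1) : ℝ) : ℂ) *
          Complex.exp (-((1 + w / T) * s))) atTop
          (𝓝 (((s ^ (a - 1) : ℝ) : ℂ) * Complex.exp (-(1 * s)))) :=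
        ((Complex.continuous_exp.tendsto _).comp (hζ.mul_const (s : ℂ)).neg).const_mul _
      rw [one_mul] at hlim
      refine hlim.congr' ?_
      filter_upwards [eventually_ge_atTop s] with T hT
      rw [indicator_of_mem (show s ∈ Iic T from hT)]
  have hpow : Tendsto (fun T : ℝ => (1 + w / T) ^ (a : ℂ)) atTop (𝓝 1) := by
    simpa [Function.comp_def] using
      (continuousAt_cpow_const (b := (a : ℂ)) Complex.one_mem_slitPlane).tendsto.comp hζ
  have hmul := hpow.mul hint
  rw [one_mul] at hmul
  refine hmul.congr' ?_
  filter_upwards [eventually_gt_atTop 0, hζ.eventually_ne one_ne_zero] with T hT hne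
  have hT' : (T : ℂ) ≠ 0 := by exact_mod_cast hT.ne'
  have hw : w + T = T * (1 + w / T) := by field_simp; ring
  rw [hw, ofReal_mul_cpow hT hne, mul_right_comm, cpow_mul_entireLowerGamma_scale a hT, mul_comm,
    integral_indicator measurableSet_Iic, Measure.restrict_restrict measurableSet_Iic,
    Iic_inter_Ioi, intervalIntegral.integral_of_le hT.le]

lemma add_ofReal_mem_slitPlane {w : ℂ} (hw : w ∈ Complex.slitPlane) {t : ℝ} (ht : 0 ≤ t) :
    w + t ∈ Complex.slitPlane := by
  rw [Complex.mem_slitPlane_iff] at hw ⊢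
  rcases hw with h | h
  · left
    simp
    linarith
  · right
    simpa using h

lemma rpow_le_of_half_le_of_le_two {x t : ℝ} (ht : 0 < t) (h1 : t / 2 ≤ x) (h2 : x ≤ 2 * t)
    (b : ℝ) : x ^ b ≤ 2 ^ |b| * t ^ b := by
  rcases le_total 0 b with hb | hb
  · rw [abs_of_nonneg hb, ← Real.mul_rpow (by norm_num) ht.le]
    exact Real.rpow_le_rpow (by linarith) h2 hb
  · rw [abs_of_nonpos hb, Real.rpow_neg (by norm_num), ← Real.inv_rpow (by norm_num),
      ← Real.mul_rpow (by norm_num) ht.le]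
    exact Real.rpow_le_rpow_of_nonpos (by linarith) (by linarith) hb

lemma integrableOn_cpow_mul_cexp_neg {a : ℝ} (ha : 0 < a) {w : ℂ} (hw : w ∈ Complex.slitPlane) :
    IntegrableOn (fun t : ℝ => (w + t) ^ ((a : ℂ) - 1) * Complex.exp (-(w + t))) (Ioi 0) := by
  have hc : ContinuousOn (fun t : ℝ => (w + t) ^ ((a : ℂ) - 1) * Complex.exp (-(w + t)))
      (Ici 0) := by
    refine ContinuousOn.mul (ContinuousOn.cpow_const (by fun_prop) fun t ht => ?_) (by fun_prop)
    exact add_ofReal_mem_slitPlane hw ht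
  -- Beyond `2‖w‖` one has `t/2 ≤ ‖w + t‖ ≤ 2t`, which controls the power whatever the sign of `a -
  -- 1`.
  set T : ℝ := 2 * ‖w‖ with hT
  have hT0 : 0 ≤ T := by positivity
  rw [← Ioc_union_Ioi_eq_Ioi hT0]
  refine IntegrableOn.union ?_ ?_
  · exact ((hc.mono Icc_subset_Ici_self).integrableOn_Icc).mono_set Ioc_subset_Icc_self
  · have hbound := ((integrableOn_rpow_mul_exp_neg ha one_pos).mono_set
      (Ioi_subset_Ioi hT0)).const_mul (2 ^ |a - 1| * Real.exp ‖w‖)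
    refine hbound.mono' ((hc.mono ?_).aestronglyMeasurable measurableSet_Ioi) ?_
    · exact fun t ht => hT0.trans (le_of_lt ht)
    · filter_upwards [ae_restrict_mem measurableSet_Ioi] with t ht
      have ht' : T < t := ht
      have ht0 : 0 < t := hT0.trans_lt ht'
      have hnt : ‖(t : ℂ)‖ = t := by rw [Complex.norm_real, Real.norm_of_nonneg ht0.le]
      have h1 : t / 2 ≤ ‖w + t‖ := by
        have := norm_sub_le_norm_add (t : ℂ) w
        rw [add_comm, hnt] at this
        linarith
      have h2 : ‖w + t‖ ≤ 2 * t := by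
        have := norm_add_le w (t : ℂ)
        rw [hnt] at this
        linarith
      have hexp : ‖Complex.exp (-(w + t))‖ ≤ Real.exp ‖w‖ * Real.exp (-1 * t) := by
        rw [Complex.norm_exp, ← Real.exp_add, Real.exp_le_exp]
        have := (abs_le.1 (Complex.abs_re_le_norm w)).1
        simp
        linarith
      rw [norm_mul, show (a : ℂ) - 1 = ((a - 1 : ℝ) : ℂ) by push_cast; rfl,
        Complex.norm_cpow_real]
      calc ‖w + t‖ ^ (a - 1) * ‖Complex.exp (-(w + t))‖
          ≤ (2 ^ |a - 1| * t ^ (a - 1)) * (Real.exp ‖w‖ * Real.exp (-1 * t)) := by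
            gcongr
            exact rpow_le_of_half_le_of_le_two ht0 h1 h2 _
        _ = _ := by ring

/-- The horizontal ray from `w` to the right never leaves the slit plane, so the antiderivative `w^a
* entireLowerGamma a w` applies along it; its limit at infinity is `Γ(a)`. -/
lemma complexUpperGamma_of_mem_slitPlane {a : ℝ} (ha : 0 < a) {w : ℂ}
    (hw : w ∈ Complex.slitPlane) :
    complexUpperGamma a w = Real.Gamma a - w ^ (a : ℂ) * entireLowerGamma a w := by
  have hd (t : ℝ) (ht : t ∈ Ici (0 : ℝ)) :
      HasDerivAt (fun t : ℝ => (w + t) ^ (a : ℂ) * entireLowerGamma a (w + t))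
        ((w + t) ^ ((a : ℂ) - 1) * Complex.exp (-(w + t))) t := by
    have h1 := hasDerivAt_cpow_mul_entireLowerGamma ha (add_ofReal_mem_slitPlane hw ht)
    have h2 : HasDerivAt (fun t : ℂ => w + t) 1 (t : ℂ) := (hasDerivAt_id (t : ℂ)).const_add w
    simpa using (HasDerivAt.comp (t : ℂ) h1 h2).comp_ofReal
  have := integral_Ioi_of_hasDerivAt_of_tendsto' hd (integrableOn_cpow_mul_cexp_neg ha hw)
    (tendsto_cpow_mul_entireLowerGamma ha w)
  simpa [complexUpperGamma] using this

/-- On the cut the ray runs through the singularity `0`, reached at `t = x`. The part after it is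
`Γ(a)`; the part before it is computed directly, the base being negative with argument `π`. -/
lemma complexUpperGamma_neg_ofReal {a x : ℝ} (ha : 0 < a) (hx : 0 < x) :
    complexUpperGamma a (-x : ℂ) =
      Real.Gamma a - (-x : ℂ) ^ (a : ℂ) * entireLowerGamma a (-x) := by
  have hpi : Complex.exp (Real.pi * Complex.I * ((a : ℂ) - 1)) =
      -Complex.exp (Real.pi * Complex.I * a) := by
    rw [mul_sub, mul_one, Complex.exp_sub, Complex.exp_pi_mul_I, div_neg, div_one]
  set f : ℝ → ℂ := fun t => ((-x : ℂ) + t) ^ ((a : ℂ) - 1) * Complex.exp (-((-x : ℂ) + t)) with hf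
  have hpos {s : ℝ} (hs : 0 < s) :
      ((s : ℝ) : ℂ) ^ ((a : ℂ) - 1) * Complex.exp (-s) =
        ((s ^ (a - 1) : ℝ) : ℂ) * Complex.exp (-s) := by
    rw [Complex.ofReal_cpow hs.le]
    push_cast
    rfl
  have hmp := measurePreserving_sub_right (volume : Measure ℝ) x
  have hme : MeasurableEmbedding fun t : ℝ => t - x := measurableEmbedding_subRight x
  have hpre : (fun t : ℝ => t - x) ⁻¹' Ioi 0 = Ioi x := by ext t; simp
  have hcongr : EqOn f ((fun s : ℝ => ((s ^ (a - 1) : ℝ) : ℂ) * Complex.exp (-s)) ∘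
      fun t => t - x) (Ioi x) := by
    intro t ht
    have := hpos (s := t - x) (sub_pos.2 ht)
    have hsub : (-x : ℂ) + t = ((t - x : ℝ) : ℂ) := by push_cast; ring
    rw [Function.comp_apply, ← this, hf]
    simp only [hsub]
  -- At `t = x - s` the base is `-s`, whose principal power is `s^(a-1) e^{iπ(a-1)}`.
  have hneg {s : ℝ} (hs : 0 < s) : f (x - s) = Complex.exp (Real.pi * Complex.I * ((a : ℂ) - 1)) *
      (((s ^ (a - 1) : ℝ) : ℂ) * Complex.exp (-(-1 * s))) := by
    have h1 : (-x : ℂ) + ((x - s : ℝ) : ℂ) = ((-s : ℝ) : ℂ) := by push_cast; ring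
    rw [hf]
    simp only
    rw [h1, Complex.ofReal_cpow_of_nonpos (by linarith), Complex.ofReal_cpow hs.le]
    push_cast
    rw [neg_neg, neg_one_mul, neg_neg]
    ring
  have hint2 : IntegrableOn f (Ioi x) := by
    refine IntegrableOn.congr_fun ?_ hcongr.symm measurableSet_Ioi
    rw [← hpre, hmp.integrableOn_comp_preimage hme]
    have h := (integrableOn_rpow_mul_exp_neg ha one_pos).ofReal (𝕜 := ℂ)
    refine h.congr (.of_forall fun s => ?_)
    simp
  have hint1 : IntervalIntegrable f volume 0 x := by
    have h := (intervalIntegrable_rpow_mul ha (f := fun s : ℝ => Complex.exp (-(-1 * s)))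
      (by fun_prop) 0 x).const_mul (Complex.exp (Real.pi * Complex.I * ((a : ℂ) - 1)))
    have h' : IntervalIntegrable (fun s => f (x - s)) volume 0 x := by
      refine h.congr fun s hs => ?_
      rw [uIoc_of_le hx.le] at hs
      exact (hneg hs.1).symm
    simpa using (h'.comp_sub_left x).symm
  have hval2 : ∫ t in Ioi x, f t = Real.Gamma a := by
    rw [setIntegral_congr_fun measurableSet_Ioi hcongr, ← setIntegral_rpow_mul_cexp_neg ha, ← hpre]
    exact hmp.setIntegral_preimage_emb hme
      (fun s : ℝ => ((s ^ (a - 1) : ℝ) : ℂ) * Complex.exp (-s)) _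
  have hval1 : ∫ t in (0 : ℝ)..x, f t = -((-x : ℂ) ^ (a : ℂ) * entireLowerGamma a (-x)) := by
    have h1 := intervalIntegral.integral_comp_sub_left (a := 0) (b := x) f x
    rw [sub_self, sub_zero] at h1
    have h2 := cpow_mul_entireLowerGamma_scale a hx (-1)
    rw [mul_neg_one] at h2
    have h3 := Complex.ofReal_cpow_of_nonpos (x := -x) (by linarith) (a : ℂ)
    push_cast at h3
    rw [neg_neg] at h3
    rw [← h1, intervalIntegral.integral_congr_ae (.of_forall fun s hs => hneg (by
        rw [uIoc_of_le hx.le] at hs; exact hs.1)),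
      intervalIntegral.integral_const_mul, ← h2, hpi, h3]
    ring
  rw [complexUpperGamma, ← intervalIntegral.integral_interval_add_Ioi' hint1 hint2, hval1, hval2]
  ring

/-- The relation between the two incomplete gamma functions, the principal branch of the power
being used throughout. -/
theorem Gamma_sub_complexUpperGamma {a : ℝ} (ha : 0 < a) {w : ℂ} (hw : w ≠ 0) :
    (Real.Gamma a : ℂ) - complexUpperGamma a w = w ^ (a : ℂ) * entireLowerGamma a w := by
  by_cases h : w ∈ Complex.slitPlane
  · rw [complexUpperGamma_of_mem_slitPlane ha h, sub_sub_cancel]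
  · rw [Complex.mem_slitPlane_iff, not_or, not_lt, not_not] at h
    have hre : w.re ≠ 0 := fun h0 => hw (Complex.ext h0 h.2)
    have hwx : w = -((-w.re : ℝ) : ℂ) := Complex.ext (by simp) (by simp [h.2])
    rw [hwx, complexUpperGamma_neg_ofReal ha (neg_pos.2 (lt_of_le_of_ne h.1 hre)), sub_sub_cancel]

/-! ### The first recipe -/

section TypeI

variable {n : ℝ}

/-- The normalized logarithmic weight `(-log v)^(n-1) / Γ(n)`. -/
def logWeight (n v : ℝ) : ℝ := (-Real.log v) ^ (n - 1) / Real.Gamma n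

lemma intervalIntegrable_logWeight (hn : 0 < n) : IntervalIntegrable (logWeight n) volume 0 1 :=
  (intervalIntegrable_neg_log_rpow hn).div_const _

lemma integral_logWeight (hn : 0 < n) : ∫ v in (0 : ℝ)..1, logWeight n v = 1 := by
  simp only [logWeight]
  rw [intervalIntegral.integral_div, integral_neg_log_rpow hn,
    div_self (Real.Gamma_pos_of_pos hn).ne']

lemma neg_log_pos {v : ℝ} (hv : v ∈ Ioo (0 : ℝ) 1) : 0 < -Real.log v :=
  neg_pos.2 (Real.log_neg hv.1 hv.2)

lemma logWeight_pos (hn : 0 < n) : ∀ v ∈ Ioo (0 : ℝ) 1, 0 < logWeight n v := fun _ hv =>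
  div_pos (Real.rpow_pos_of_pos (neg_log_pos hv) _) (Real.Gamma_pos_of_pos hn)

lemma continuousOn_logWeight (n : ℝ) : ContinuousOn (logWeight n) (Ioo 0 1) := by
  refine ContinuousOn.div_const (ContinuousOn.rpow_const ?_ fun v hv =>
    Or.inl (neg_log_pos hv).ne') _
  exact (Real.continuousOn_log.mono fun v hv => hv.1.ne').neg

/-- Under `v = e^{-y}` the regularized gamma function is the mass of the weight on `(0, e^{-y})`,
complementary to the tail since the total mass is `1`. -/
lemma upperGamma_div_eq (hn : 0 < n) {y : ℝ} (hy : 0 ≤ y) :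
    upperGamma n y / Real.Gamma n = 1 - ∫ w in Real.exp (-y)..1, logWeight n w := by
  have hmem : Real.exp (-y) ∈ Icc (0 : ℝ) 1 :=
    ⟨(Real.exp_pos _).le, Real.exp_le_one_iff.2 (neg_nonpos.2 hy)⟩
  have hi := intervalIntegrable_logWeight hn
  have h := intervalIntegral.integral_add_adjacent_intervals (b := Real.exp (-y))
    (hi.mono_set (by
      rw [uIcc_of_le zero_le_one]; exact uIcc_subset_Icc ⟨le_rfl, zero_le_one⟩ hmem))
    (hi.mono_set (by
      rw [uIcc_of_le zero_le_one]; exact uIcc_subset_Icc hmem ⟨zero_le_one, le_rfl⟩))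
  rw [integral_logWeight hn] at h
  refine eq_sub_of_add_eq (Eq.trans ?_ h)
  rw [← setIntegral_neg_log_rpow, intervalIntegral.integral_of_le hmem.1,
    integral_Ioc_eq_integral_Ioo]
  simp only [logWeight]
  rw [integral_div]

/-- Strict monotonicity of the tail makes the set in the definition of `inverseGammaQ` a singleton.
-/
lemma inverseGammaQ_eq (hn : 0 < n) {y : ℝ} (hy : 0 ≤ y) :
    inverseGammaQ n (upperGamma n y / Real.Gamma n) = y := by
  have : {x : ℝ | 0 ≤ x ∧ upperGamma n x / Real.Gamma n = upperGamma n y / Real.Gamma n} = {y} := by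
    ext x
    refine ⟨fun ⟨hx, h⟩ => ?_, fun h => ?_⟩
    · rw [upperGamma_div_eq hn hx, upperGamma_div_eq hn hy, sub_right_inj] at h
      have hinj := (strictAntiOn_tail (intervalIntegrable_logWeight hn) (logWeight_pos hn)
        (G := fun v => ∫ w in v..1, logWeight n w) fun _ _ => rfl).injOn
      have := hinj ⟨(Real.exp_pos _).le, Real.exp_le_one_iff.2 (neg_nonpos.2 hx)⟩
        ⟨(Real.exp_pos _).le, Real.exp_le_one_iff.2 (neg_nonpos.2 hy)⟩ h
      exact neg_injective (Real.exp_injective this)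
    · rw [mem_singleton_iff.1 h]
      exact ⟨hy, rfl⟩
  rw [inverseGammaQ, this, csInf_singleton]

lemma inverseGammaQ_one_sub_tail (hn : 0 < n) {v : ℝ} (hv : v ∈ Ioo (0 : ℝ) 1) :
    inverseGammaQ n (1 - ∫ w in v..1, logWeight n w) = -Real.log v := by
  have h := upperGamma_div_eq hn (neg_log_pos hv).le
  rw [neg_neg, Real.exp_log hv.1] at h
  rw [← h, inverseGammaQ_eq hn (neg_log_pos hv).le]

/-- The substitution `z = G(v)` has Jacobian `(-log v)^(n-1)/Γ(n)`, and it cancels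
`Γ(n)/Q(n,1-z)^(n-1)` because `Q(n, 1-G(v)) = -log v`. -/
lemma integral_exp_tail_logWeight (hn : 0 < n) (u : ℂ) :
    ∫ v in (0 : ℝ)..1, Complex.exp (-u * ((∫ w in v..1, logWeight n w : ℝ) : ℂ)) =
      (Real.Gamma n : ℂ) * ∫ z in (0 : ℝ)..1,
        Complex.exp (-u * z) / ((inverseGammaQ n (1 - z) ^ (n - 1) : ℝ) : ℂ) := by
  have hi := intervalIntegrable_logWeight hn
  have hG : ∀ v ∈ Icc (0 : ℝ) 1,
      ∫ w in v..1, logWeight n w = (fun v => ∫ w in v..1, logWeight n w) v := fun _ _ => rfl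
  have himg := image_tail_Ioo hi (logWeight_pos hn) hG
  rw [integral_logWeight hn] at himg
  rw [← intervalIntegral.integral_const_mul, intervalIntegral.integral_of_le zero_le_one,
    intervalIntegral.integral_of_le zero_le_one, integral_Ioc_eq_integral_Ioo,
    integral_Ioc_eq_integral_Ioo]
  conv_rhs => rw [← himg]
  rw [integral_image_eq_integral_abs_deriv_smul measurableSet_Ioo
    (fun v hv => hasDerivWithinAt_tail hi (continuousOn_logWeight n) hG hv)
    ((strictAntiOn_tail hi (logWeight_pos hn) hG).injOn.mono Ioo_subset_Icc_self)]
  refine setIntegral_congr_fun measurableSet_Ioo fun v hv => ?_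
  have h1 : ((-Real.log v) ^ (n - 1) : ℝ) ≠ 0 := (Real.rpow_pos_of_pos (neg_log_pos hv) _).ne'
  have h1' : (((-Real.log v) ^ (n - 1) : ℝ) : ℂ) ≠ 0 := by exact_mod_cast h1
  have h2 : (Real.Gamma n : ℂ) ≠ 0 := by exact_mod_cast (Real.Gamma_pos_of_pos hn).ne'
  rw [inverseGammaQ_one_sub_tail hn hv, abs_neg, abs_of_pos (logWeight_pos hn v hv),
    Complex.real_smul, logWeight, Complex.ofReal_div]
  field_simp

lemma densityI_tail_mul (hn : 0 < n) (lam : ℝ≥0) {v : ℝ} (hv : v ∈ Ioo (0 : ℝ) 1) :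
    densityI lam n (∫ w in v..1, logWeight n w) * logWeight n v = lam := by
  have hmem : (∫ w in v..1, logWeight n w) ∈ Ioo (0 : ℝ) 1 := by
    have himg := image_tail_Ioo (intervalIntegrable_logWeight hn) (logWeight_pos hn)
      (G := fun v => ∫ w in v..1, logWeight n w) fun _ _ => rfl
    rw [integral_logWeight hn] at himg
    rw [← himg]
    exact mem_image_of_mem _ hv
  have h1 : ((-Real.log v) ^ (n - 1) : ℝ) ≠ 0 := (Real.rpow_pos_of_pos (neg_log_pos hv) _).ne'
  have h2 := (Real.Gamma_pos_of_pos hn).ne'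
  rw [densityI, indicator_of_mem (Ioo_subset_Ioc_self hmem), inverseGammaQ_one_sub_tail hn hv,
    logWeight]
  field_simp

theorem IsPoissonProcess.typeI {Ω : Type u} [MeasurableSpace Ω] {P : Measure Ω} {lam : ℝ≥0}
    (hlam : 0 < lam) {X : ℝ≥0 → Ω → ℝ} (hX : IsPoissonProcess X lam P) (hn : 0 < n)
    {A : ℝ≥0 → Ω → ℝ} (hA : IsTypeIAverage X n A) :
    (∀ u : ℂ, laplace (A 1) P u = Complex.exp ((lam : ℂ) *
      ((Real.Gamma n : ℂ) * (∫ z in (0 : ℝ)..1,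
        Complex.exp (-u * z) / ((inverseGammaQ n (1 - z) ^ (n - 1) : ℝ) : ℂ)) - 1))) ∧
    HasBoundedJumpDensity.{u, v} A P lam (densityI lam n) 1 := by
  have h := hX.laplace_and_hasBoundedJumpDensity.{u, v} hlam (intervalIntegrable_logWeight hn)
    (logWeight_pos hn) (continuousOn_logWeight n)
    (G := fun v => ∫ w in v..1, logWeight n w) (fun _ _ => rfl) (ℓ := densityI lam n)
    (fun v hv => densityI_tail_mul hn lam hv)
    (fun z hz => by
      rw [integral_logWeight hn] at hz
      exact indicator_of_notMem hz _)
    (fun ω t hω => hA.eq_integral hω t)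
  simp only [integral_exp_tail_logWeight hn, integral_logWeight hn] at h
  exact h

end TypeI

/-! ### The third recipe -/

section TypeIII

variable {n : ℝ}

lemma integral_one_sub_rpow (hn : 0 < n) (v : ℝ) :
    ∫ w in v..1, (1 - w) ^ (n - 1) / Real.Gamma n = (1 - v) ^ n / Real.Gamma (n + 1) := by
  rw [intervalIntegral.integral_comp_sub_left (fun x => x ^ (n - 1) / Real.Gamma n),
    intervalIntegral.integral_div, integral_rpow (Or.inl (by linarith)), sub_self,
    sub_add_cancel, Real.zero_rpow hn.ne', Real.Gamma_add_one hn.ne', sub_zero, div_div]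

lemma intervalIntegrable_one_sub_rpow (hn : 0 < n) :
    IntervalIntegrable (fun w => (1 - w) ^ (n - 1) / Real.Gamma n) volume 0 1 := by
  have h : IntervalIntegrable (fun x : ℝ => x ^ (n - 1)) volume 0 1 :=
    intervalIntegral.intervalIntegrable_rpow' (by linarith)
  simpa using ((h.comp_sub_left 1).symm).div_const (Real.Gamma n)

/-- Reflection `v ↦ 1 - v` followed by `v = r^(1/n)`, whose Jacobian is `r^(1/n-1)/n`. -/
lemma integral_exp_one_sub_rpow (hn : 0 < n) (w : ℂ) :
    ∫ v in (0 : ℝ)..1, Complex.exp (-(w * (((1 - v) ^ n : ℝ) : ℂ))) =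
      entireLowerGamma (1 / n) w / n := by
  have hn' : (0 : ℝ) < 1 / n := by positivity
  rw [intervalIntegral.integral_comp_sub_left
      (fun v : ℝ => Complex.exp (-(w * ((v ^ n : ℝ) : ℂ)))), sub_self, sub_zero,
    intervalIntegral.integral_of_le zero_le_one, integral_Ioc_eq_integral_Ioo]
  have himg : (fun r : ℝ => r ^ (1 / n)) '' Ioo 0 1 = Ioo 0 1 := by
    refine Subset.antisymm ?_ fun v hv => ⟨v ^ n, ⟨?_, ?_⟩, ?_⟩
    · rintro _ ⟨r, hr, rfl⟩
      exact ⟨Real.rpow_pos_of_pos hr.1 _, Real.rpow_lt_one hr.1.le hr.2 hn'⟩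
    · exact Real.rpow_pos_of_pos hv.1 _
    · exact Real.rpow_lt_one hv.1.le hv.2 hn
    · simp only
      rw [← Real.rpow_mul hv.1.le, mul_one_div_cancel hn.ne', Real.rpow_one]
  conv_lhs => rw [← himg]
  rw [integral_image_eq_integral_abs_deriv_smul measurableSet_Ioo
    (fun r hr => (Real.hasDerivAt_rpow_const (Or.inl hr.1.ne')).hasDerivWithinAt) ?_,
    entireLowerGamma, intervalIntegral.integral_of_le zero_le_one, integral_Ioc_eq_integral_Ioo,
    ← integral_div]
  · refine setIntegral_congr_fun measurableSet_Ioo fun r hr => ?_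
    have hp := Real.rpow_pos_of_pos hr.1 (1 / n - 1)
    rw [abs_of_pos (mul_pos hn' hp), ← Real.rpow_mul hr.1.le, one_div_mul_cancel hn.ne',
      Real.rpow_one, Complex.real_smul]
    push_cast
    ring
  · intro r hr s hs h
    exact (Real.rpow_left_inj hr.1.le hs.1.le hn'.ne').1 h

lemma densityIII_mul (hn : 0 < n) (lam : ℝ≥0) {v : ℝ} (hv : v ∈ Ioo (0 : ℝ) 1) :
    densityIII lam n ((1 - v) ^ n / Real.Gamma (n + 1)) * ((1 - v) ^ (n - 1) / Real.Gamma n) =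
      lam := by
  have hv' : 0 < 1 - v := by linarith [hv.2]
  have hΓ := Real.Gamma_pos_of_pos hn
  have hΓ' : 0 < Real.Gamma (n + 1) := Real.Gamma_pos_of_pos (by linarith)
  have hp := Real.rpow_pos_of_pos hv' n
  have hmem : (1 - v) ^ n / Real.Gamma (n + 1) ∈ Ioc 0 (1 / Real.Gamma (n + 1)) := by
    refine ⟨div_pos hp hΓ', ?_⟩
    gcongr
    exact Real.rpow_le_one hv'.le (by linarith [hv.1]) hn.le
  rw [densityIII, indicator_of_mem hmem, mul_div_cancel₀ _ hΓ'.ne', ← Real.rpow_mul hv'.le,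
    mul_one_div_cancel hn.ne', Real.rpow_one, Real.rpow_sub_one hv'.ne', Real.Gamma_add_one hn.ne']
  field_simp

/-- A form free of branches and valid also at `u = 0`; the incomplete gamma formulas and the
continuous extension are deduced from it. -/
lemma IsPoissonProcess.typeIII_entire {Ω : Type u} [MeasurableSpace Ω] {P : Measure Ω}
    {lam : ℝ≥0} (hlam : 0 < lam) {X : ℝ≥0 → Ω → ℝ} (hX : IsPoissonProcess X lam P) (hn : 0 < n)
    {A : ℝ≥0 → Ω → ℝ} (hA : IsTypeIIIAverage X n A) :
    (∀ u : ℂ, laplace (A 1) P u = Complex.exp ((lam : ℂ) *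
      (entireLowerGamma (1 / n) (u / Real.Gamma (n + 1)) / n - 1))) ∧
    HasBoundedJumpDensity.{u, v} A P lam (densityIII lam n) (1 / Real.Gamma (n + 1)) := by
  have h0 : (1 - (0 : ℝ)) ^ n / Real.Gamma (n + 1) = 1 / Real.Gamma (n + 1) := by simp
  have h := hX.laplace_and_hasBoundedJumpDensity.{u, v} hlam (intervalIntegrable_one_sub_rpow hn)
    (fun v hv => div_pos (Real.rpow_pos_of_pos (by linarith [hv.2]) _) (Real.Gamma_pos_of_pos hn))
    (ContinuousOn.div_const (ContinuousOn.rpow_const (by fun_prop) fun v hv =>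
      Or.inl (by linarith [hv.2])) _)
    (G := fun v => (1 - v) ^ n / Real.Gamma (n + 1)) (fun v _ => integral_one_sub_rpow hn v)
    (ℓ := densityIII lam n) (fun v hv => densityIII_mul hn lam hv)
    (fun z hz => by
      rw [h0] at hz
      exact indicator_of_notMem hz _)
    (fun ω t hω => hA.eq_integral hω t)
  rw [h0] at h
  refine ⟨fun u => ?_, h.2⟩
  rw [h.1, ← integral_exp_one_sub_rpow hn]
  congr 4
  ext v
  push_cast
  ring_nf

lemma cpow_neg_mul_Gamma_sub (hn : 0 < n) {w : ℂ} (hw : w ≠ 0) :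
    w ^ (-((1 : ℂ) / n)) * ((Real.Gamma (1 / n) : ℂ) - complexUpperGamma (1 / n) w) / n =
      entireLowerGamma (1 / n) w / n := by
  have h := Gamma_sub_complexUpperGamma (a := 1 / n) (by positivity) hw
  push_cast at h
  rw [h, Complex.cpow_neg, inv_mul_cancel_left₀ (by simp [Complex.cpow_eq_zero_iff, hw])]

theorem IsPoissonProcess.typeIII {Ω : Type u} [MeasurableSpace Ω] {P : Measure Ω} {lam : ℝ≥0}
    (hlam : 0 < lam) {X : ℝ≥0 → Ω → ℝ} (hX : IsPoissonProcess X lam P) (hn : 0 < n)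
    {A : ℝ≥0 → Ω → ℝ} (hA : IsTypeIIIAverage X n A) :
    (∀ u ∈ Complex.slitPlane, laplace (A 1) P u = Complex.exp ((lam : ℂ) *
      (((Real.Gamma (n + 1) : ℂ) / u) ^ ((1 : ℂ) / n) *
        ((Real.Gamma (1 / n) : ℂ) - complexUpperGamma (1 / n) (u / Real.Gamma (n + 1))) / n
          - 1))) ∧
    (∀ u : ℂ, u ≠ 0 → laplace (A 1) P u = Complex.exp ((lam : ℂ) *
      ((u / (Real.Gamma (n + 1) : ℂ)) ^ (-((1 : ℂ) / n)) *
        ((Real.Gamma (1 / n) : ℂ) - complexUpperGamma (1 / n) (u / Real.Gamma (n + 1))) / n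
          - 1))) ∧
    Tendsto (fun u : ℂ => Complex.exp ((lam : ℂ) *
      ((u / (Real.Gamma (n + 1) : ℂ)) ^ (-((1 : ℂ) / n)) *
        ((Real.Gamma (1 / n) : ℂ) - complexUpperGamma (1 / n) (u / Real.Gamma (n + 1))) / n
          - 1))) (𝓝[≠] 0) (𝓝 (laplace (A 1) P 0)) ∧
    HasBoundedJumpDensity.{u, v} A P lam (densityIII lam n) (1 / Real.Gamma (n + 1)) := by
  obtain ⟨h1, h2⟩ := hX.typeIII_entire.{u, v} hlam hn hA
  have hΓ : 0 < Real.Gamma (n + 1) := Real.Gamma_pos_of_pos (by linarith)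
  have hΓ' : (Real.Gamma (n + 1) : ℂ) ≠ 0 := by exact_mod_cast hΓ.ne'
  have key (u : ℂ) (hu : u ≠ 0) : laplace (A 1) P u = Complex.exp ((lam : ℂ) *
      ((u / (Real.Gamma (n + 1) : ℂ)) ^ (-((1 : ℂ) / n)) *
        ((Real.Gamma (1 / n) : ℂ) - complexUpperGamma (1 / n) (u / Real.Gamma (n + 1))) / n
          - 1)) := by
    rw [h1, cpow_neg_mul_Gamma_sub hn (div_ne_zero hu hΓ')]
  refine ⟨fun u hu => ?_, key, ?_, h2⟩
  -- Inversion commutes with the principal power when the argument is not `π`; this is where the cut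
  -- has to be excluded.
  · rw [key u (Complex.slitPlane_ne_zero hu), ← inv_div u, Complex.inv_cpow, ← Complex.cpow_neg]
    have hmem : u / (Real.Gamma (n + 1) : ℂ) ∈ Complex.slitPlane := by
      rw [div_eq_mul_inv, ← Complex.ofReal_inv, Complex.mem_slitPlane_iff, Complex.re_mul_ofReal,
        Complex.im_mul_ofReal]
      have := inv_pos.2 hΓ
      exact (Complex.mem_slitPlane_iff.1 hu).imp (fun h => mul_pos h this)
        fun h => mul_ne_zero h this.ne'
    exact Complex.slitPlane_arg_ne_pi hmem
  · have hc : Continuous fun u : ℂ => laplace (A 1) P u := by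
      have hE : Continuous (entireLowerGamma (1 / n)) :=
        continuous_iff_continuousAt.2 fun w =>
          (hasDerivAt_entireLowerGamma (by positivity) w).continuousAt
      simp only [h1]
      fun_prop
    refine ((hc.tendsto 0).mono_left nhdsWithin_le_nhds).congr' ?_
    filter_upwards [self_mem_nhdsWithin] with u hu using key u hu

end TypeIII

/-! ### The second recipe -/

/-- The `k`-fold average of the exponential function, `∑ w^m / (m! (m+1)^k)`. -/
def averagedExp : ℕ → ℂ → ℂ
  | 0, w => Complex.exp w
  | k + 1, w => ∫ v in (0 : ℝ)..1, averagedExp k (w * v)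

lemma continuous_averagedExp (k : ℕ) : Continuous (averagedExp k) := by
  induction k with
  | zero => exact Complex.continuous_exp
  | succ k ih =>
    refine intervalIntegral.continuous_parametric_intervalIntegral_of_continuous' ?_ 0 1
    simp only [Function.uncurry_def]
    fun_prop

/-- Averaging against `g` multiplies the `m`-th coefficient by the `m`-th moment of `g`.
Coefficients in `[0,1]` keep the series dominated by the exponential one. -/
lemma hasSum_integral_pow_series {c : ℕ → ℝ} (hc : ∀ m, 0 ≤ c m) (hc1 : ∀ m, c m ≤ 1)
    {g : ℝ → ℝ} (hg : IntervalIntegrable g volume 0 1) (w : ℂ) {f : ℂ → ℂ}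
    (hf : ∀ w : ℂ, HasSum (fun m : ℕ => w ^ m / (m ! : ℂ) * c m) (f w)) :
    HasSum (fun m : ℕ => w ^ m / (m ! : ℂ) * (c m * ∫ v in (0 : ℝ)..1, g v * v ^ m : ℝ))
      (∫ v in (0 : ℝ)..1, (g v : ℂ) * f (w * v)) := by
  have hsum : Summable fun m : ℕ => ‖w‖ ^ m / (m ! : ℝ) := Real.summable_pow_div_factorial _
  have h := intervalIntegral.hasSum_integral_of_dominated_convergence (μ := volume) (a := 0)
    (b := 1) (F := fun (m : ℕ) (v : ℝ) => (g v : ℂ) * ((w * v) ^ m / (m ! : ℂ) * c m))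
    (f := fun v => (g v : ℂ) * f (w * v)) (fun m v => ‖g v‖ * (‖w‖ ^ m / (m ! : ℝ)))
    (fun m => ?_) (fun m => .of_forall fun v hv => ?_)
    (.of_forall fun v _ => hsum.mul_left _) ?_ (.of_forall fun v _ => (hf _).mul_left _)
  · convert! h using 2 with m
    have (v : ℝ) : (g v : ℂ) * ((w * v) ^ m / (m ! : ℂ) * c m) =
        (w ^ m / (m ! : ℂ) * c m) * ((g v * v ^ m : ℝ) : ℂ) := by
      push_cast
      ring
    simp only [this]
    rw [intervalIntegral.integral_const_mul, intervalIntegral.integral_ofReal]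
    push_cast
    ring
  · have := (intervalIntegrable_iff.1 hg).aestronglyMeasurable
    refine AEStronglyMeasurable.fun_mul ?_ (by fun_prop)
    exact Complex.continuous_ofReal.comp_aestronglyMeasurable this
  · rw [uIoc_of_le zero_le_one] at hv
    rw [norm_mul, Complex.norm_real, norm_mul, norm_div, norm_pow, norm_mul, Complex.norm_real,
      Complex.norm_real, Complex.norm_natCast, Real.norm_of_nonneg (hc m),
      Real.norm_of_nonneg hv.1.le]
    refine mul_le_mul_of_nonneg_left ?_ (norm_nonneg _)
    have h0 : 0 ≤ ‖w‖ * v := mul_nonneg (norm_nonneg _) hv.1.le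
    refine (mul_le_of_le_one_right (by positivity) (hc1 m)).trans ?_
    gcongr
    exact mul_le_of_le_one_right (norm_nonneg _) hv.2
  · simp only [tsum_mul_left]
    exact hg.norm.mul_const _

lemma inv_succ_pow_le_one (m k : ℕ) : (((m + 1 : ℝ)) ^ k)⁻¹ ≤ 1 :=
  inv_le_one_of_one_le₀ (one_le_pow₀ (by simp))

lemma hasSum_averagedExp (k : ℕ) (w : ℂ) :
    HasSum (fun m : ℕ => w ^ m / (m ! : ℂ) * ((((m + 1 : ℝ)) ^ k)⁻¹ : ℝ)) (averagedExp k w) := by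
  induction k generalizing w with
  | zero =>
    have := NormedSpace.expSeries_div_hasSum_exp w
    rw [← Complex.exp_eq_exp_ℂ] at this
    simpa [averagedExp] using this
  | succ k ih =>
    have h := hasSum_integral_pow_series (c := fun m => ((m + 1 : ℝ) ^ k)⁻¹)
      (fun m => by positivity) (fun m => inv_succ_pow_le_one m k) (g := fun _ => 1) (by simp) w ih
    simp only [Complex.ofReal_one, one_mul, integral_pow, one_pow] at h
    convert! h using 4 with m
    rw [pow_succ, mul_inv]
    simp

/-- With `v = e^{-y}` this is a gamma integral of rate `m + 1`. -/
lemma integral_neg_log_rpow_mul_pow {n : ℝ} (hn : 0 < n) (m : ℕ) :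
    ∫ v in (0 : ℝ)..1, logWeight n v * v ^ m = ((m + 1 : ℝ) ^ n)⁻¹ := by
  have hm : (0 : ℝ) < m + 1 := by positivity
  have h := setIntegral_comp_neg_log (fun y => logWeight n (Real.exp (-y)) * Real.exp (-(m * y))) 0
  rw [neg_zero, Real.exp_zero] at h
  rw [intervalIntegral.integral_of_le zero_le_one, integral_Ioc_eq_integral_Ioo,
    setIntegral_congr_fun (g := fun v => logWeight n (Real.exp (-(-Real.log v))) *
      Real.exp (-(m * -Real.log v))) measurableSet_Ioo fun v hv => ?_, h]
  · have hΓ := Real.integral_rpow_mul_exp_neg_mul_Ioi hn hm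
    have heq (y : ℝ) : Real.exp (-y) • (logWeight n (Real.exp (-y)) * Real.exp (-(m * y))) =
        (y ^ (n - 1) * Real.exp (-((m + 1) * y))) / Real.Gamma n := by
      rw [logWeight, Real.log_exp, neg_neg, smul_eq_mul,
        show -((m + 1 : ℝ) * y) = -y + -(m * y) by ring, Real.exp_add]
      ring
    simp only [heq]
    rw [integral_div, hΓ, mul_div_cancel_right₀ _ (Real.Gamma_pos_of_pos hn).ne',
      Real.div_rpow zero_le_one hm.le, Real.one_rpow, one_div]
  · simp only
    rw [neg_neg, mul_neg, neg_neg, Real.exp_log hv.1, Real.exp_nat_mul, Real.exp_log hv.1]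

lemma hasSum_integral_logWeight_mul_exp {n : ℝ} (hn : 0 < n) (w : ℂ) :
    HasSum (fun m : ℕ => w ^ m / (m ! : ℂ) * (((m + 1 : ℝ) ^ n)⁻¹ : ℝ))
      (∫ v in (0 : ℝ)..1, (logWeight n v : ℂ) * Complex.exp (w * v)) := by
  have h := hasSum_integral_pow_series (c := fun _ => 1) (fun _ => zero_le_one) (fun _ => le_rfl)
    (intervalIntegrable_logWeight hn) w (f := Complex.exp) fun w => by
      simpa [averagedExp] using hasSum_averagedExp 0 w
  simpa only [integral_neg_log_rpow_mul_pow hn, one_mul] using h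

/-- Both sides have the same power series; this reconciles the integer recipe with the fractional
one. -/
lemma averagedExp_eq_integral {k : ℕ} (hk : (0 : ℝ) < k) (w : ℂ) :
    averagedExp k w = ∫ v in (0 : ℝ)..1, (logWeight k v : ℂ) * Complex.exp (w * v) := by
  refine (hasSum_averagedExp k w).unique ?_
  simpa only [Real.rpow_natCast] using hasSum_integral_logWeight_mul_exp hk w

/-- The Pochhammer symbols are `(1)_m = m!` and `(2)_m = (m+1)!`, so each parameter pair contributes
`1/(m+1)`. -/
lemma genHypergeometric_replicate (k : ℕ) (w : ℂ) :
    genHypergeometric (List.replicate k 1) (List.replicate k 2) w = averagedExp k w := by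
  rw [genHypergeometric, ← (hasSum_averagedExp k w).tsum_eq]
  refine tsum_congr fun m => ?_
  have h2 : (ascPochhammer ℂ m).eval 2 = ((m + 1)! : ℂ) := by
    have h3 := ascPochhammer_nat_eq_natCast_ascFactorial ℂ 2 m
    rw [Nat.cast_ofNat] at h3
    rw [h3]
    have h4 := Nat.factorial_mul_ascFactorial 1 m
    rw [Nat.factorial_one, one_mul, add_comm 1 m] at h4
    exact_mod_cast h4
  have hm : (m ! : ℂ) ≠ 0 := by exact_mod_cast m.factorial_ne_zero
  have hm' : (m + 1 : ℂ) ≠ 0 := by exact_mod_cast m.succ_ne_zero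
  rw [List.map_replicate, List.map_replicate, List.prod_replicate, List.prod_replicate,
    ascPochhammer_eval_one, h2, ← div_pow, Nat.factorial_succ]
  push_cast
  rw [div_mul_cancel_right₀ hm, inv_pow]
  ring

/-! ### One-dimensional laws along the second recipe. -/

section Laws

variable {Ω Ω' : Type u} [MeasurableSpace Ω] [MeasurableSpace Ω'] {P : Measure Ω} {lam : ℝ≥0}
  {X : ℝ≥0 → Ω → ℝ}

/-- The constant weight `1` has tail `1 - v`, so the exponent at `ξ` is replaced by its mean over
`[0, ξ]`, which is one more step of `averagedExp`. -/
lemma runningAverage_law {Y : ℝ≥0 → Ω' → ℝ} {Q : Measure Ω'} {k : ℕ} (hY : IsLevyProcess Y Q)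
    (hnn : ∀ t, ∀ᵐ ω ∂Q, 0 ≤ Y t ω)
    (hchar : ∀ (t : ℝ≥0) (ξ : ℝ), charFun (Q.map (Y t)) ξ =
      Complex.exp (t * (lam * (averagedExp k (ξ * Complex.I) - 1)))) (t : ℝ≥0) :
    AEMeasurable (runningAverage Y t) Q ∧ (∀ᵐ ω ∂Q, 0 ≤ runningAverage Y t ω) ∧
    ∀ ξ : ℝ, charFun (Q.map (runningAverage Y t)) ξ =
      Complex.exp (t * (lam * (averagedExp (k + 1) (ξ * Complex.I) - 1))) := by
  have hcE := continuous_averagedExp k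
  have hmain := hY.charFun_weighted_integral hnn (by fun_prop) hchar
    (g := fun _ => (1 : ℝ)) (by simp) t
  have hpath := hY.ae_isSubordinatorPath hnn
  have heq : (fun ω => ∫ v in (0 : ℝ)..1, Y (t * v.toNNReal) ω * 1) =ᵐ[Q] runningAverage Y t := by
    filter_upwards [hpath] with ω hω
    rw [runningAverage_eq hω.zero]
    simp only [mul_one]
  refine ⟨hmain.1.congr heq, ?_, fun ξ => ?_⟩
  · filter_upwards [hpath] with ω hω
    rw [runningAverage_eq hω.zero]
    exact intervalIntegral.integral_nonneg zero_le_one fun v _ => hω.nonneg _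
  · rw [← Measure.map_congr heq, hmain.2]
    congr 2
    simp only [intervalIntegral.integral_const, smul_eq_mul, mul_one]
    rw [intervalIntegral.integral_comp_sub_left (fun x : ℝ =>
      (lam : ℂ) * (averagedExp k (((ξ * x : ℝ) : ℂ) * Complex.I) - 1)), sub_self, sub_zero,
      intervalIntegral.integral_const_mul, intervalIntegral.integral_sub
        (Continuous.intervalIntegrable (by fun_prop) _ _) (by simp), averagedExp]
    simp only [intervalIntegral.integral_const, sub_zero, one_smul]
    congr 3
    ext v
    push_cast
    ring_nf

/-- Nonnegativity is carried through the induction because it makes the paths of the next clock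
monotone. The probability space changes at each level. -/
lemma IsTypeIIClock.law (hX : IsPoissonProcess X lam P) {k : ℕ} {Y : ℝ≥0 → Ω' → ℝ}
    {Q : Measure Ω'} (hY : IsTypeIIClock X P k Y Q) :
    IsLevyProcess Y Q ∧ (∀ t, ∀ᵐ ω ∂Q, 0 ≤ Y t ω) ∧
    ∀ (t : ℝ≥0) (ξ : ℝ), charFun (Q.map (Y t)) ξ =
      Complex.exp (t * (lam * (averagedExp k (ξ * Complex.I) - 1))) := by
  induction k generalizing Ω' with
  | zero =>
    refine ⟨hY.1, fun t => ?_, fun t ξ => ?_⟩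
    · exact (hY.2 t).symm.ae_mem_snd measurableSet_Ici (hX.ae_nonneg t)
    · rw [(hY.2 t).map_eq, hX.charFun_eq, averagedExp]
  | succ k ih =>
    obtain ⟨Ω₀, _, Y₀, Q₀, hY₀, hY⟩ := hY
    obtain ⟨h1, h2, h3⟩ := ih hY₀
    have hlaw (t : ℝ≥0) := runningAverage_law h1 h2 h3 t
    refine ⟨hY.1, fun t => ?_, fun t ξ => ?_⟩
    · exact (hY.2 t).symm.ae_mem_snd measurableSet_Ici (hlaw t).2.1
    · rw [(hY.2 t).map_eq, (hlaw t).2.2]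

lemma charFun_map_eq_laplace {Z : Ω → ℝ} (hZ : AEMeasurable Z P) (ξ : ℝ) :
    charFun (P.map Z) ξ = laplace Z P (-(ξ * Complex.I)) := by
  rw [charFun_apply_real, integral_map hZ (by fun_prop), laplace, complexMGF, neg_neg]
  simp only [mul_right_comm]

/-- Uniqueness of the continuous logarithm: `f` takes values in `2πiℤ`, and a continuous
integer-valued function on the line is constant. -/
lemma eq_zero_of_exp_eq_one {f : ℝ → ℂ} (hf : Continuous f) (h0 : f 0 = 0)
    (hexp : ∀ x, Complex.exp (f x) = 1) (x : ℝ) : f x = 0 := by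
  choose m hm using fun x => Complex.exp_eq_one_iff.1 (hexp x)
  have hcont : Continuous m := by
    rw [Int.isClosedEmbedding_coe_real.isEmbedding.continuous_iff]
    have : ((↑) : ℤ → ℝ) ∘ m = fun x => (f x / (2 * Real.pi * Complex.I)).re := by
      ext x
      rw [hm x, mul_div_cancel_right₀ _ Complex.two_pi_I_ne_zero]
      simp
    rw [this]
    fun_prop
  have hconst : m x = m 0 := PreconnectedSpace.constant inferInstance hcont
  rw [hm x, hconst, ← hm 0, h0]

/-- Only the imaginary axis matters, since characteristic functions already determine the laws. -/
lemma IsPoissonProcess.logLaplace_eq (hX : IsPoissonProcess X lam P) {ψ : ℂ → ℂ}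
    (hψ : IsLogLaplace (X 1) P ψ) (ξ : ℝ) :
    ψ (-(ξ * Complex.I)) = lam * (Complex.exp (ξ * Complex.I) - 1) := by
  obtain ⟨hc, h0, hexp⟩ := hψ
  have hmem (x : ℝ) : -((x : ℂ) * Complex.I) ∈ {u : ℂ | 0 ≤ u.re} := by simp
  refine sub_eq_zero.1 (eq_zero_of_exp_eq_one
    (f := fun x : ℝ => ψ (-(x * Complex.I)) - lam * (Complex.exp (x * Complex.I) - 1))
    ?_ (by simp [h0]) (fun x => ?_) ξ)
  · exact (hc.comp_continuous (by fun_prop) hmem).sub (by fun_prop)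
  · rw [Complex.exp_sub, ← hexp _ (hmem x),
      ← charFun_map_eq_laplace (hX.levy.measurable 1).aemeasurable, hX.charFun_eq]
    simp [Complex.exp_ne_zero]

lemma intervalIntegrable_logWeight_mul {n : ℝ} (hn : 0 < n) {f : ℝ → ℂ} (hf : Continuous f) :
    IntervalIntegrable (fun v => (logWeight n v : ℂ) * f v) volume 0 1 := by
  have h := intervalIntegrable_logWeight hn
  have h' : IntervalIntegrable (fun v => (logWeight n v : ℂ)) volume 0 1 := ⟨h.1.ofReal, h.2.ofReal⟩
  exact h'.mul_continuousOn hf.continuousOn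

lemma integral_logWeight_mul_exp_sub_one {n : ℝ} (hn : 0 < n) (w : ℂ) :
    ∫ v in (0 : ℝ)..1, (logWeight n v : ℂ) * (Complex.exp (w * v) - 1) =
      (∫ v in (0 : ℝ)..1, (logWeight n v : ℂ) * Complex.exp (w * v)) - 1 := by
  simp only [mul_sub]
  rw [intervalIntegral.integral_sub (intervalIntegrable_logWeight_mul hn (by fun_prop))
    (intervalIntegrable_logWeight_mul hn (by fun_prop))]
  simp only [mul_one]
  rw [intervalIntegral.integral_ofReal, integral_logWeight hn, Complex.ofReal_one]

/-- Both descriptions of the type II average have the same one-dimensional laws. -/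
lemma IsTypeIIAverage.law (hX : IsPoissonProcess X lam P) {n : ℝ} (hn : 0 < n) {Q : Measure Ω'}
    {A : ℝ≥0 → Ω' → ℝ} (hA : IsTypeIIAverage X P Q n A) :
    IsProbabilityMeasure Q ∧ (∀ t, AEMeasurable (A t) Q) ∧
    ∀ (t : ℝ≥0) (ξ : ℝ), charFun (Q.map (A t)) ξ = Complex.exp (lam * t *
      ((∫ v in (0 : ℝ)..1, (logWeight n v : ℂ) * Complex.exp (ξ * Complex.I * v)) - 1)) := by
  rcases hA with ⟨k, Y, hY⟩ | ⟨n, _, A, hQ, hA, ψ, hψ, h⟩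
  · obtain ⟨h1, h2, h3⟩ := hY.law hX
    have hlaw (t : ℝ≥0) := runningAverage_law h1 h2 h3 t
    refine ⟨h1.isProbabilityMeasure, fun t => (hlaw t).1, fun t ξ => ?_⟩
    rw [(hlaw t).2.2, averagedExp_eq_integral hn]
    ring_nf
  · refine ⟨hQ, hA, fun t ξ => ?_⟩
    rw [charFun_map_eq_laplace (hA t), h t _ (by simp), ← integral_logWeight_mul_exp_sub_one hn]
    congr 1
    rw [← intervalIntegral.integral_const_mul, ← intervalIntegral.integral_const_mul]
    refine intervalIntegral.integral_congr fun v _ => ?_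
    have hv := hX.logLaplace_eq hψ (ξ * v)
    push_cast at hv
    have h1 : -((ξ : ℂ) * Complex.I) * v = -(ξ * v * Complex.I) := by ring
    have h2 : (ξ : ℂ) * v * Complex.I = ξ * Complex.I * v := by ring
    simp only [logWeight]
    rw [h1, hv, h2, Complex.ofReal_div]
    ring

end Laws

/-! ### The logarithmic weight as jump density of type II. -/

lemma densityII_div {lam : ℝ≥0} (hlam : 0 < lam) (n : ℝ) :
    (fun z => densityII lam n z / lam) = (Ioc (0 : ℝ) 1).indicator (logWeight n) := by
  have hlam' : (lam : ℝ) ≠ 0 := by exact_mod_cast hlam.ne'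
  ext z
  by_cases hz : z ∈ Ioc (0 : ℝ) 1
  · rw [densityII, indicator_of_mem hz, indicator_of_mem hz, logWeight]
    field_simp
  · rw [densityII, indicator_of_notMem hz, indicator_of_notMem hz, zero_div]

lemma logWeight_nonneg {n : ℝ} (hn : 0 < n) {v : ℝ} (hv : v ∈ Ioc (0 : ℝ) 1) : 0 ≤ logWeight n v :=
  div_nonneg (Real.rpow_nonneg (neg_nonneg.2 (Real.log_nonpos hv.1.le hv.2)) _)
    (Real.Gamma_pos_of_pos hn).le

lemma isProbabilityMeasure_density_logWeight {n : ℝ} (hn : 0 < n) :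
    IsProbabilityMeasure (densityMeasure ((Ioc (0 : ℝ) 1).indicator (logWeight n))) := by
  constructor
  have hind : (fun z => ENNReal.ofReal ((Ioc (0 : ℝ) 1).indicator (logWeight n) z)) =
      (Ioc (0 : ℝ) 1).indicator fun z => ENNReal.ofReal (logWeight n z) := by
    ext z
    by_cases hz : z ∈ Ioc (0 : ℝ) 1 <;> simp [hz]
  rw [densityMeasure, withDensity_apply _ MeasurableSet.univ, Measure.restrict_univ, hind,
    lintegral_indicator measurableSet_Ioc, ← ofReal_integral_eq_lintegral_ofReal
    ((intervalIntegrable_iff_integrableOn_Ioc_of_le zero_le_one).1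
      (intervalIntegrable_logWeight hn))
    (ae_restrict_of_forall_mem measurableSet_Ioc fun v hv => logWeight_nonneg hn hv),
    ← intervalIntegral.integral_of_le zero_le_one, integral_logWeight hn, ENNReal.ofReal_one]

lemma integral_density_logWeight {n : ℝ} (hn : 0 < n) (f : ℝ → ℂ) :
    ∫ z, f z ∂(densityMeasure ((Ioc (0 : ℝ) 1).indicator (logWeight n))) =
      ∫ v in (0 : ℝ)..1, (logWeight n v : ℂ) * f v := by
  have hm : Measurable (logWeight n) := by unfold logWeight; fun_prop
  rw [densityMeasure, integral_withDensity_eq_integral_toReal_smul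
      (hm.indicator measurableSet_Ioc).ennreal_ofReal (by simp),
    intervalIntegral.integral_of_le zero_le_one, ← integral_indicator measurableSet_Ioc]
  refine integral_congr_ae (.of_forall fun z => ?_)
  by_cases hz : z ∈ Ioc (0 : ℝ) 1
  · simp [indicator_of_mem hz, logWeight_nonneg hn hz]
  · simp [indicator_of_notMem hz]

/-- The fractional description gives no pathwise formula, only laws, so the argument starts from
characteristic functions; the jump density is the logarithmic weight itself, not the inverse of a
tail. -/
theorem IsPoissonProcess.typeII {Ω Ω' : Type u} [MeasurableSpace Ω] [MeasurableSpace Ω']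
    {P : Measure Ω} {lam : ℝ≥0} (hlam : 0 < lam) {X : ℝ≥0 → Ω → ℝ}
    (hX : IsPoissonProcess X lam P) {n : ℝ} (hn : 0 < n) {Q : Measure Ω'} {A : ℝ≥0 → Ω' → ℝ}
    (hA : IsTypeIIAverage X P Q n A) :
    (∀ u : ℂ, laplace (A 1) Q u = Complex.exp ((lam : ℂ) / (Real.Gamma n : ℂ) *
      ∫ v in (0 : ℝ)..1,
        (((-Real.log v) ^ (n - 1) : ℝ) : ℂ) * (Complex.exp (-u * v) - 1))) ∧
    (∀ k : ℕ, n = k → ∀ u : ℂ, laplace (A 1) Q u = Complex.exp ((lam : ℂ) *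
      (genHypergeometric (List.replicate k 1) (List.replicate k 2) (-u) - 1))) ∧
    HasBoundedJumpDensity.{u, v} A Q lam (densityII lam n) 1 := by
  obtain ⟨hQ, hAm, hchar⟩ := hA.law hX hn
  have h := laplace_and_hasBoundedJumpDensity_of_charFun.{u, v} (A := A) (P := Q) hlam
    (ℓ := densityII lam n) (b := 1) hAm
    (by rw [densityII_div hlam]; exact isProbabilityMeasure_density_logWeight hn)
    (by
      rw [densityII_div hlam, densityMeasure, withDensity_apply _ measurableSet_Ioc.compl,
        setLIntegral_congr_fun (g := fun _ => 0) measurableSet_Ioc.compl fun z hz => by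
          simp [indicator_of_notMem hz]]
      simp)
    (fun t ξ => by
      rw [hchar, charFun_apply_real, densityII_div hlam, integral_density_logWeight hn]
      simp only [mul_right_comm (ξ : ℂ) Complex.I])
  simp only [densityII_div hlam, integral_density_logWeight hn] at h
  refine ⟨fun u => ?_, fun k hk u => ?_, h.2⟩
  · rw [h.1, ← integral_logWeight_mul_exp_sub_one hn, ← intervalIntegral.integral_const_mul,
      ← intervalIntegral.integral_const_mul]
    congr 2
    ext v
    rw [logWeight, Complex.ofReal_div]
    ring
  · subst hk
    rw [h.1, genHypergeometric_replicate, averagedExp_eq_integral hn]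

end RegulatedClock

end

theorem proposition1 {Ω : Type u} [MeasurableSpace Ω] (P : Measure Ω) (lam : ℝ≥0) (hlam : 0 < lam)
    (X : ℝ≥0 → Ω → ℝ) (hX : IsPoissonProcess X lam P) (n : ℝ) (hn : 0 < n) :
    -- type I
    (∀ A : ℝ≥0 → Ω → ℝ, IsTypeIAverage X n A →
      (∀ u : ℂ, laplace (A 1) P u = Complex.exp ((lam : ℂ) *
        ((Real.Gamma n : ℂ) * (∫ z in (0 : ℝ)..1,
          Complex.exp (-u * z) / ((inverseGammaQ n (1 - z) ^ (n - 1) : ℝ) : ℂ)) - 1))) ∧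
      HasBoundedJumpDensity.{u, v} A P lam (densityI lam n) 1) ∧
    -- type II
    (∀ {Ω' : Type u} [MeasurableSpace Ω'] (Q : Measure Ω') (A : ℝ≥0 → Ω' → ℝ),
      IsTypeIIAverage X P Q n A →
      (∀ u : ℂ, laplace (A 1) Q u = Complex.exp ((lam : ℂ) / (Real.Gamma n : ℂ) *
        ∫ v in (0 : ℝ)..1,
          (((-Real.log v) ^ (n - 1) : ℝ) : ℂ) * (Complex.exp (-u * v) - 1))) ∧
      (∀ k : ℕ, n = k → ∀ u : ℂ, laplace (A 1) Q u = Complex.exp ((lam : ℂ) *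
        (genHypergeometric (List.replicate k 1) (List.replicate k 2) (-u) - 1))) ∧
      HasBoundedJumpDensity.{u, v} A Q lam (densityII lam n) 1) ∧
    -- type III
    (∀ A : ℝ≥0 → Ω → ℝ, IsTypeIIIAverage X n A →
      -- the formula, off the branch cut of the powers
      (∀ u ∈ Complex.slitPlane, laplace (A 1) P u = Complex.exp ((lam : ℂ) *
        (((Real.Gamma (n + 1) : ℂ) / u) ^ ((1 : ℂ) / n) *
          ((Real.Gamma (1 / n) : ℂ) - complexUpperGamma (1 / n) (u / Real.Gamma (n + 1))) / n
            - 1))) ∧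
      -- the formula for every nonzero `u`, with one branch of the power `(u / Γ(n+1)) ^ (1/n)`
      (∀ u : ℂ, u ≠ 0 → laplace (A 1) P u = Complex.exp ((lam : ℂ) *
        ((u / (Real.Gamma (n + 1) : ℂ)) ^ (-((1 : ℂ) / n)) *
          ((Real.Gamma (1 / n) : ℂ) - complexUpperGamma (1 / n) (u / Real.Gamma (n + 1))) / n
            - 1))) ∧
      -- the formula at `u = 0`, a removable singularity
      Tendsto (fun u : ℂ => Complex.exp ((lam : ℂ) *
        ((u / (Real.Gamma (n + 1) : ℂ)) ^ (-((1 : ℂ) / n)) *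
          ((Real.Gamma (1 / n) : ℂ) - complexUpperGamma (1 / n) (u / Real.Gamma (n + 1))) / n
            - 1))) (𝓝[≠] 0) (𝓝 (laplace (A 1) P 0)) ∧
      HasBoundedJumpDensity.{u, v} A P lam (densityIII lam n) (1 / Real.Gamma (n + 1))) := by
  exact ⟨fun A hA => hX.typeI hlam hn hA, fun Q A hA => hX.typeII hlam hn hA,
    fun A hA => hX.typeIII hlam hn hA⟩
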